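/- Let $F$ be a non-archimedean local field of characteristic zero with ring of integers $\mathfrak o$, maximal ideal $\mathfrak p$ and uniformizer $\varpi$. Let $a,b\in\mathfrak o$, $c\in\mathfrak o^\times$ with $d:=b^2-4ac\neq 0$. Put $L=F(\sqrt d)$ if $d\notin F^{\times2}$ and $L=F\oplus F$ if $d\in F^{\times 2}$. Assume that $d$ generates the discriminant of $L/F$ if $d\notin F^{\times2}$, and that $d\in\mathfrak o^\times$ if $d\in F^{\times2}$. Set $\left(\frac L{\mathfrak p}\right)=-1$ if $d\notin F^{\times2}$ and $d\notin\mathfrak p$ (inert), $0$ if $d\notin F^{\times2}$ and $d\in\mathfrak p$ (ramified), and $1$ if $d\in F^{\times2}$ (split). If $L$ is a field, let $\mathfrak o_L$ be its ring of integers, $\mathfrak p_L$ the maximal ideal of $\mathfrak o_L$, and $\alpha=\frac{b+\sqrt d}{2c}\in\mathfrak o_L$. For a commutative ring $A$ let $\mathrm{GSp}_4(A)=\{g\in\mathrm{GL}_4(A): {}^tgJg=\mu J,\ \mu\in A^\times\}$ with $J=\begin{bmatrix}&1_2\\-1_2&\end{bmatrix}$. Let $K^H=\mathrm{GSp}_4(\mathfrak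 o)$ and $$\mathrm I=\left\{g\in K^H: g\equiv\begin{bmatrix}*&0&*&*\\ *&*&*&*\\0&0&*&*\\0&0&0&*\end{bmatrix}\pmod{\mathfrak p}\right\}.$$ Let $S=\begin{bmatrix}a&b/2\\b/2&c\end{bmatrix}$ and $T(F)=\{g\in\mathrm{GL}_2(F):{}^tgSg=\det(g)S\}$, embedded in $\mathrm{GSp}_4(F)$ by $g\mapsto\begin{bmatrix}g&\\&\det(g)\,{}^tg^{-1}\end{bmatrix}$. Let $U(F)=\left\{\begin{bmatrix}1_2&X\\&1_2\end{bmatrix}:X\in M_2(F),\ {}^tX=X\right\}$ and $R(F)=T(F)U(F)$. For $l\in\mathbb Z$, $m\ge 0$ and $w\in\mathfrak o$ put $$h(l,m)=\mathrm{diag}(\varpi^{2m+l},\varpi^{m+l},1,\varpi^m),\qquad W_w=\begin{bmatrix}1&&&\\w&1&&\\&&1&-w\\&&&1\end{bmatrix},$$ $$s_1=\begin{bmatrix}&1&&\\1&&&\\&&&1\\&&1&\end{bmatrix},\qquad s_2=\begin{bmatrix}&&1&\\&1&&\\-1&&&\\&&&1\end{bmatrix},$$ $$W=\{1,s_1,s_2,s_1s_2,s_2s_1,s_1s_2s_1,s_2s_1s_2,s_1s_2s_1s_2\},\qquad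 W^{(1)}=\{1,s_2,s_2s_1,s_2s_1s_2\}.$$ If $\left(\frac L{\mathfrak p}\right)=0$, there is a unique class $w_0\in\mathfrak o/\mathfrak p$ such that $\alpha+w_0\in\mathfrak p_L$ (for every, equivalently some, representative of the class). Below, $w_0$ also denotes any representative in $\mathfrak o$; if $\#(\mathfrak o/\mathfrak p)$ is odd, then $-b/(2c)\in\mathfrak o$ is such a representative. If $\left(\frac L{\mathfrak p}\right)=1$, let $\sqrt d$ be either square root of $d$ in $F$; then $\frac{-b\pm\sqrt d}{2c}\in\mathfrak o$. For every $l\in\mathbb Z$ and $m\geq0$ the following decompositions hold, and all the unions are disjoint: $$R(F)h(l,m)K^H=\begin{cases}\bigsqcup\limits_{s\in W}R(F)h(l,m)s\,\mathrm I,&m>0;\\[2ex] \bigsqcup\limits_{s\in W^{(1)}}R(F)h(l,0)s\,\mathrm I,&m=0,\ \left(\frac L{\mathfrak p}\right)=-1;\\[2ex] \bigsqcup\limits_{s\in W^{(1)}}\Big(R(F)h(l,0)s\,\mathrm I\ \sqcup\ R(F)h(l,0)W_{w_0}s_1s\,\mathrm I\Big),&m=0,\ \left(\frac L{\mathfrak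 p}\right)=0;\\[2ex] \bigsqcup\limits_{s\in W^{(1)}}\Big(R(F)h(l,0)s\,\mathrm I\ \sqcup\ R(F)h(l,0)W_{\frac{-b+\sqrt d}{2c}}s_1s\,\mathrm I\ \sqcup\ R(F)h(l,0)W_{\frac{-b-\sqrt d}{2c}}s_1s\,\mathrm I\Big),&m=0,\ \left(\frac L{\mathfrak p}\right)=1.\end{cases}$$ -/

import Mathlib

open scoped ValuativeRel

namespace BesselCosets

noncomputable section

/-! ### The group `GSp₄` and some of its elements -/

/-- The `4 × 4` matrix with `2 × 2` blocks `A`, `B` (upper row) and `C`, `D` (lower row). -/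
def block4 {R : Type*} (A B C D : Matrix (Fin 2) (Fin 2) R) : Matrix (Fin 4) (Fin 4) R :=
  !![A 0 0, A 0 1, B 0 0, B 0 1;
     A 1 0, A 1 1, B 1 0, B 1 1;
     C 0 0, C 0 1, D 0 0, D 0 1;
     C 1 0, C 1 1, D 1 0, D 1 1]

/-- The symplectic form `J` with blocks `0, 1, -1, 0`. -/
def formJ (R : Type*) [CommRing R] : Matrix (Fin 4) (Fin 4) R := block4 0 1 (-1) 0

/-- `GSp₄(R) = {g ∈ GL₄(R) : ᵗg J g = μ J for some μ ∈ Rˣ}`. -/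
def GSp4 (R : Type*) [CommRing R] : Subgroup (GL (Fin 4) R) where
  carrier := {g | ∃ μ : Rˣ, (g.val).transpose * formJ R * g.val = (μ : R) • formJ R}
  one_mem' := ⟨1, by simp⟩
  mul_mem' := by
    rintro g h ⟨μ, hg⟩ ⟨ν, hh⟩
    refine ⟨μ * ν, ?_⟩
    calc ((g * h).val).transpose * formJ R * (g * h).val
        = (h.val).transpose * ((g.val).transpose * formJ R * g.val) * h.val := by
          simp only [Units.val_mul, Matrix.transpose_mul, Matrix.mul_assoc]
      _ = ((μ * ν : Rˣ) : R) • formJ R := by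
          rw [hg, Matrix.mul_smul, Matrix.smul_mul, hh, smul_smul, Units.val_mul]
  inv_mem' := by
    rintro g ⟨μ, hg⟩
    refine ⟨μ⁻¹, ?_⟩
    have h1 : g.val * (g⁻¹).val = 1 := Units.mul_inv g
    have h2 : ((g⁻¹).val).transpose * (g.val).transpose = 1 := by
      rw [← Matrix.transpose_mul, h1, Matrix.transpose_one]
    have h3 : (μ : R) • (((g⁻¹).val).transpose * formJ R * (g⁻¹).val) = formJ R := by
      calc (μ : R) • (((g⁻¹).val).transpose * formJ R * (g⁻¹).val)
          = ((g⁻¹).val).transpose * ((μ : R) • formJ R) * (g⁻¹).val := by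
            rw [Matrix.mul_smul, Matrix.smul_mul]
        _ = (((g⁻¹).val).transpose * (g.val).transpose) * formJ R * (g.val * (g⁻¹).val) := by
            rw [← hg]; simp only [Matrix.mul_assoc]
        _ = formJ R := by rw [h1, h2, one_mul, mul_one]
    calc ((g⁻¹).val).transpose * formJ R * (g⁻¹).val
        = ((μ⁻¹ : Rˣ) : R) • ((μ : R) • (((g⁻¹).val).transpose * formJ R * (g⁻¹).val)) := by
          rw [smul_smul, Units.inv_mul, one_smul]
      _ = ((μ⁻¹ : Rˣ) : R) • formJ R := by rw [h3]

/-- The generator `s₁` of the Weyl group. -/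
def s1 (R : Type*) [CommRing R] : GL (Fin 4) R where
  val := !![0, 1, 0, 0; 1, 0, 0, 0; 0, 0, 0, 1; 0, 0, 1, 0]
  inv := !![0, 1, 0, 0; 1, 0, 0, 0; 0, 0, 0, 1; 0, 0, 1, 0]
  val_inv := by
    ext i j; fin_cases i <;> fin_cases j <;> simp [Matrix.mul_apply, Fin.sum_univ_four]
  inv_val := by
    ext i j; fin_cases i <;> fin_cases j <;> simp [Matrix.mul_apply, Fin.sum_univ_four]

/-- The generator `s₂` of the Weyl group. -/
def s2 (R : Type*) [CommRing R] : GL (Fin 4) R where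
  val := !![0, 0, 1, 0; 0, 1, 0, 0; -1, 0, 0, 0; 0, 0, 0, 1]
  inv := !![0, 0, -1, 0; 0, 1, 0, 0; 1, 0, 0, 0; 0, 0, 0, 1]
  val_inv := by
    ext i j; fin_cases i <;> fin_cases j <;> simp [Matrix.mul_apply, Fin.sum_univ_four]
  inv_val := by
    ext i j; fin_cases i <;> fin_cases j <;> simp [Matrix.mul_apply, Fin.sum_univ_four]

/-- The Weyl group `W` of `Sp₄`, as a set of eight representatives in `GL₄`. -/
def weyl (R : Type*) [CommRing R] : Set (GL (Fin 4) R) :=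
  {1, s1 R, s2 R, s1 R * s2 R, s2 R * s1 R, s1 R * s2 R * s1 R, s2 R * s1 R * s2 R,
    s1 R * s2 R * s1 R * s2 R}

/-- The set `W⁽¹⁾` of representatives of `{1, s₁} \ W`. -/
def weylOne (R : Type*) [CommRing R] : Set (GL (Fin 4) R) :=
  {1, s2 R, s2 R * s1 R, s2 R * s1 R * s2 R}

/-- The unipotent matrix `W_w`. -/
def unipW {R : Type*} [CommRing R] (w : R) : GL (Fin 4) R where
  val := !![1, 0, 0, 0; w, 1, 0, 0; 0, 0, 1, -w; 0, 0, 0, 1]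
  inv := !![1, 0, 0, 0; -w, 1, 0, 0; 0, 0, 1, w; 0, 0, 0, 1]
  val_inv := by
    ext i j; fin_cases i <;> fin_cases j <;> simp [Matrix.mul_apply, Fin.sum_univ_four]
  inv_val := by
    ext i j; fin_cases i <;> fin_cases j <;> simp [Matrix.mul_apply, Fin.sum_univ_four]

/-- The diagonal matrix `h(l,m) = diag(ϖ^(2m+l), ϖ^(m+l), 1, ϖ^m)`. -/
def hlm {F : Type*} [Field F] (ϖ : Fˣ) (l : ℤ) (m : ℕ) : GL (Fin 4) F where
  val := Matrix.diagonal
    ![(ϖ : F) ^ (2 * (m : ℤ) + l), (ϖ : F) ^ ((m : ℤ) + l), 1, (ϖ : F) ^ (m : ℤ)]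
  inv := Matrix.diagonal
    ![(ϖ : F) ^ (-(2 * (m : ℤ) + l)), (ϖ : F) ^ (-((m : ℤ) + l)), 1, (ϖ : F) ^ (-(m : ℤ))]
  val_inv := by
    rw [Matrix.diagonal_mul_diagonal, ← Matrix.diagonal_one]
    congr 1
    funext i
    fin_cases i <;> simp [-neg_add_rev, zpow_ne_zero]
  inv_val := by
    rw [Matrix.diagonal_mul_diagonal, ← Matrix.diagonal_one]
    congr 1
    funext i
    fin_cases i <;> simp [-neg_add_rev, zpow_ne_zero]

/-! ### The Bessel subgroup -/

/-- The discriminant `b² - 4ac`. -/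
def disc {R : Type*} [CommRing R] (a b c : R) : R := b ^ 2 - 4 * a * c

/-- The symmetric matrix `S` with rows `(a, b/2)` and `(b/2, c)`. -/
def matS {F : Type*} [Field F] (a b c : F) : Matrix (Fin 2) (Fin 2) F :=
  !![a, b / 2; b / 2, c]

/-- `T(F) = {g ∈ GL₂(F) : ᵗg S g = det(g) S}`. -/
def torusT {F : Type*} [Field F] (a b c : F) : Set (GL (Fin 2) F) :=
  {g | (g.val).transpose * matS a b c * g.val = (g.val).det • matS a b c}

/-- `T(F)` inside `GSp₄(F)`, through `g ↦ diag(g, det(g) ᵗg⁻¹)`. -/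
def torusT4 {F : Type*} [Field F] (a b c : F) : Set (GL (Fin 4) F) :=
  {t | ∃ g ∈ torusT a b c,
    t.val = block4 g.val 0 0 ((g.val).det • ((g⁻¹ : GL (Fin 2) F).val).transpose)}

/-- `U(F)`, the unipotent radical of the Siegel parabolic subgroup. -/
def unipU (F : Type*) [Field F] : Set (GL (Fin 4) F) :=
  {u | ∃ X : Matrix (Fin 2) (Fin 2) F, X.transpose = X ∧ u.val = block4 1 X 0 1}

/-- The Bessel subgroup `R(F) = T(F) U(F)`. -/
def besselR {F : Type*} [Field F] (a b c : F) : Set (GL (Fin 4) F) :=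
  {r | ∃ t ∈ torusT4 a b c, ∃ u ∈ unipU F, r = t * u}

/-! ### Compact subgroups, the quadratic extension, disjoint unions -/

section LocalField

variable (F : Type*) [Field F] [ValuativeRel F]

/-- `K^H = GSp₄(𝔬)`, inside `GL₄(F)`. -/
def maxCompact : Set (GL (Fin 4) F) :=
  {g | ∃ k ∈ GSp4 𝒪[F], g = Matrix.GeneralLinearGroup.map (algebraMap 𝒪[F] F) k}

/-- The Iwahori subgroup: the elements of `GSp₄(𝔬)` that modulo `𝔭` have the shape
`(∗ 0 ∗ ∗ ; ∗ ∗ ∗ ∗ ; 0 0 ∗ ∗ ; 0 0 0 ∗)`. -/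
def iwahori : Set (GL (Fin 4) F) :=
  {g | ∃ k ∈ GSp4 𝒪[F],
    (k.val 0 1 ∈ 𝓂[F] ∧ k.val 2 0 ∈ 𝓂[F] ∧ k.val 2 1 ∈ 𝓂[F] ∧
      k.val 3 0 ∈ 𝓂[F] ∧ k.val 3 1 ∈ 𝓂[F] ∧ k.val 3 2 ∈ 𝓂[F]) ∧
    g = Matrix.GeneralLinearGroup.map (algebraMap 𝒪[F] F) k}

variable {F}

/-- The algebra `F[√d]`, with `√d` the element `ω`. It is the field `L = F(√d)` when `d` is not
a square in `F`; it is used below only in that case. -/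
abbrev QuadExt (d : F) : Type _ := QuadraticAlgebra F d 0

/-- The ring of integers of `F(√d)`, that is, the integral closure of `𝔬`. -/
abbrev integersL (d : F) : Subalgebra 𝒪[F] (QuadExt d) := integralClosure 𝒪[F] (QuadExt d)

/-- The discriminant ideal of `F(√d)/F`: the ideal of `𝔬` generated by the discriminants of all
the `F`-bases of `F(√d)` that consist of integral elements. -/
def discIdeal (d : F) : Ideal 𝒪[F] :=
  Ideal.span {δ | ∃ v : Module.Basis (Fin 2) F (QuadExt d),
    (∀ i, v i ∈ integersL d) ∧ Algebra.discr F v = (δ : F)}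

/-- `α = (b + √d) / (2c)` with `d = b² - 4ac`. -/
def alpha (a b c : F) : QuadExt (disc a b c) :=
  (2 * c)⁻¹ • (algebraMap F (QuadExt (disc a b c)) b + QuadraticAlgebra.omega)

open scoped Classical in
/-- The symbol `(L/𝔭)` of `L/F` with discriminant `d`: `1` in the split case, `0` in the ramified
case, `-1` in the inert case. -/
def legendreL (d : 𝒪[F]) : ℤ :=
  if IsSquare (d : F) then 1 else if d ∈ 𝓂[F] then 0 else -1

end LocalField

/-- `X` is the disjoint union of the family `f`. -/
def IsDisjointUnion {α ι : Type*} (X : Set α) (f : ι → Set α) : Prop :=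
  X = ⋃ i, f i ∧ Pairwise (Function.onFun Disjoint f)

/-- The double coset `R(F) g I`. -/
def cosetRI {F : Type*} [Field F] [ValuativeRel F] (a b c : F) (g : GL (Fin 4) F) :
    Set (GL (Fin 4) F) :=
  DoubleCoset.doubleCoset g (besselR a b c) (iwahori F)

/-- The double coset `R(F) g K^H`. -/
def cosetRK {F : Type*} [Field F] [ValuativeRel F] (a b c : F) (g : GL (Fin 4) F) :
    Set (GL (Fin 4) F) :=
  DoubleCoset.doubleCoset g (besselR a b c) (maxCompact F)

end

end BesselCosets

/-!
Everything is reduced to the residue field `k` of `𝔬`. Since the Iwahori subgroup is the preimage in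
`K = GSp₄(𝔬)` of a Borel subgroup `B` of `GSp₄(k)`, the double cosets in `R(F) h(l,m) K` correspond
to the double cosets `Γ \ GSp₄(k) / B`, where `Γ` is the image in `GSp₄(k)` of the intersection of
`h(l,m)⁻¹ R(F) h(l,m)` with `K`. Conjugation by `h(l,m)` turns the torus elements
`x + y (b, c ; -a, 0)` into those for the coefficients `ϖ²ᵐ a, ϖᵐ b, c`, so that `Γ` is again a
Bessel subgroup, for the reduction of these coefficients (`exists_of_conj_mem`,
`conj_unipElt_mem`, `conj_torusElt_mem`). In particular the case `m > 0` is that of the degenerate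
form `c w²`.

Over any field `k` and for any `a, b, c` with `c ≠ 0`, the double cosets are found as follows
(`exists_eq_bessel_mul_borel` and `eq_of_mem_borel`). The Bruhat decomposition relative to the Siegel
parabolic subgroup has the four cells indexed by `W⁽¹⁾`. Inside each of them, what remains are the
orbits of the torus on the lines of `k²`: the lines spanned by `(1, w)` with `c w² + b w + a = 0`
are fixed by the torus, and all the other lines form a single orbit, that of `(0, 1)`. So there are
four double cosets, plus four for each zero `w` in `k` of `c w² + b w + a`. Lifting this to `F`
gives `isDisjointUnion_cosetRI`.

It remains to count the zeros. In the inert case there is none, for Hensel's lemma would make the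
discriminant a square (`isSquare_disc_of_root`). In the ramified case the discriminant vanishes in
the finite field `k`, so that there is exactly one (`existsUnique_root_of_disc_eq_zero`), and it is
the class `w₀` because `α + w` lies in the maximal ideal exactly if its norm, which is
`(c w² + b w + a) / c`, lies in `𝔭` (`exists_mem_maximal_iff`). In the split case both zeros of the
polynomial in `F` are integral, and they are distinct modulo `𝔭` because the discriminant is a unit.
-/

namespace BesselCosets

/-! ### Subgroups of `GSp₄` cut out by the vanishing of entries -/

section Symplectic

variable {R : Type*} [CommRing R]

theorem mem_GSp4_iff {g : GL (Fin 4) R} :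
    g ∈ GSp4 R ↔ ∃ μ : Rˣ, g.val.transpose * formJ R * g.val = (μ : R) • formJ R :=
  Iff.rfl

theorem formJ_mul_formJ : formJ R * formJ R = -1 := by
  ext i j; fin_cases i <;> fin_cases j <;>
    simp [formJ, block4, Matrix.mul_apply, Fin.sum_univ_four]

/-- `GSp₄` is stable under transposition. -/
theorem mul_formJ_mul_transpose {M : Matrix (Fin 4) (Fin 4) R} {μ : Rˣ}
    (h : M.transpose * formJ R * M = (μ : R) • formJ R) :
    M * formJ R * M.transpose = (μ : R) • formJ R := by
  have h1 : (-(((μ⁻¹ : Rˣ) : R) • (formJ R * M.transpose * formJ R))) * M = 1 := by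
    rw [neg_mul, Matrix.smul_mul, Matrix.mul_assoc, Matrix.mul_assoc,
      ← Matrix.mul_assoc M.transpose, h, Matrix.mul_smul, smul_smul, formJ_mul_formJ]
    simp
  have h2 := mul_eq_one_comm.mp h1
  have h3 : M * formJ R * M.transpose * (formJ R * formJ R) = -((μ : R) • formJ R) := by
    have := congrArg (fun N => (μ : R) • (N * formJ R)) h2
    simp only [mul_neg, neg_mul, Matrix.mul_smul, Matrix.smul_mul, smul_neg, smul_smul,
      Units.mul_inv, one_smul, one_mul] at this
    rw [← this]
    simp only [Matrix.mul_assoc, neg_neg]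
  rw [formJ_mul_formJ] at h3
  simpa using h3

/-- The inverse of a symplectic similitude with blocks `A, B, C, D` and multiplier `μ` has the
blocks `Dᵀ, -Bᵀ, -Cᵀ, Aᵀ`, divided by `μ`. -/
theorem GSp4_inv_val {g : GL (Fin 4) R} {μ : Rˣ}
    (h : g.val.transpose * formJ R * g.val = (μ : R) • formJ R) :
    (g⁻¹).val = ((μ⁻¹ : Rˣ) : R) • !![g.val 2 2, g.val 3 2, -g.val 0 2, -g.val 1 2;
      g.val 2 3, g.val 3 3, -g.val 0 3, -g.val 1 3;
      -g.val 2 0, -g.val 3 0, g.val 0 0, g.val 1 0;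
      -g.val 2 1, -g.val 3 1, g.val 0 1, g.val 1 1] := by
  have h1 : (-(((μ⁻¹ : Rˣ) : R) • (formJ R * g.val.transpose * formJ R))) * g.val = 1 := by
    rw [neg_mul, Matrix.smul_mul, Matrix.mul_assoc, Matrix.mul_assoc,
      ← Matrix.mul_assoc g.val.transpose, h, Matrix.mul_smul, smul_smul, formJ_mul_formJ]
    simp
  have h2 : (g⁻¹).val = -(((μ⁻¹ : Rˣ) : R) • (formJ R * g.val.transpose * formJ R)) := by
    calc (g⁻¹).val = (-(((μ⁻¹ : Rˣ) : R) • (formJ R * g.val.transpose * formJ R)) * g.val)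
          * (g⁻¹).val := by rw [h1, one_mul]
      _ = _ := by rw [Matrix.mul_assoc, Units.mul_inv, mul_one]
  rw [h2]
  ext i j; fin_cases i <;> fin_cases j <;>
    simp [formJ, block4, Matrix.mul_apply, Matrix.vecMul, dotProduct, Fin.sum_univ_four]

/-- The determinant of a matrix with vanishing lower left `2 × 2` block. -/
theorem det_eq_of_lowerLeft {M : Matrix (Fin 4) (Fin 4) R} (h20 : M 2 0 = 0) (h21 : M 2 1 = 0)
    (h30 : M 3 0 = 0) (h31 : M 3 1 = 0) :
    M.det = (M 0 0 * M 1 1 - M 0 1 * M 1 0) * (M 2 2 * M 3 3 - M 2 3 * M 3 2) := by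
  simp [Matrix.det_succ_row_zero, Fin.sum_univ_succ, Fin.succAbove, h20, h21, h30, h31]
  ring

variable (R)

/-- The Siegel parabolic subgroup of `GSp₄`: the lower left `2 × 2` block vanishes. -/
def siegelParabolic : Subgroup (GL (Fin 4) R) where
  carrier := {g | g ∈ GSp4 R ∧
    g.val 2 0 = 0 ∧ g.val 2 1 = 0 ∧ g.val 3 0 = 0 ∧ g.val 3 1 = 0}
  one_mem' := ⟨one_mem _, by simp⟩
  mul_mem' := by
    rintro g h ⟨hg, h1, h2, h3, h4⟩ ⟨hh, k1, k2, k3, k4⟩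
    refine ⟨mul_mem hg hh, ?_⟩
    simp [Matrix.mul_apply, Fin.sum_univ_four, *]
  inv_mem' := by
    rintro g ⟨hg, h1, h2, h3, h4⟩
    obtain ⟨μ, hμ⟩ := mem_GSp4_iff.1 hg
    refine ⟨inv_mem hg, ?_⟩
    rw [GSp4_inv_val hμ]
    simp [*]

/-- The Levi subgroup of the Siegel parabolic subgroup: both off-diagonal `2 × 2` blocks vanish. -/
def siegelLevi : Subgroup (GL (Fin 4) R) where
  carrier := {g | g ∈ siegelParabolic R ∧
    g.val 0 2 = 0 ∧ g.val 0 3 = 0 ∧ g.val 1 2 = 0 ∧ g.val 1 3 = 0}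
  one_mem' := ⟨one_mem _, by simp⟩
  mul_mem' := by
    rintro g h ⟨hg, h1, h2, h3, h4⟩ ⟨hh, k1, k2, k3, k4⟩
    refine ⟨mul_mem hg hh, ?_⟩
    simp [Matrix.mul_apply, Fin.sum_univ_four, *]
  inv_mem' := by
    rintro g ⟨hg, h1, h2, h3, h4⟩
    obtain ⟨μ, hμ⟩ := mem_GSp4_iff.1 hg.1
    refine ⟨inv_mem hg, ?_⟩
    rw [GSp4_inv_val hμ]
    simp [*]

/-- The Borel subgroup of `GSp₄` whose elements have the shape
`(∗ 0 ∗ ∗ ; ∗ ∗ ∗ ∗ ; 0 0 ∗ ∗ ; 0 0 0 ∗)`. -/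
def borel : Subgroup (GL (Fin 4) R) where
  carrier := {g | g ∈ siegelParabolic R ∧ g.val 0 1 = 0 ∧ g.val 3 2 = 0}
  one_mem' := ⟨one_mem _, by simp⟩
  mul_mem' := by
    rintro g h ⟨hg, h1, h2⟩ ⟨hh, k1, k2⟩
    refine ⟨mul_mem hg hh, ?_⟩
    obtain ⟨-, g1, g2, g3, g4⟩ := hg
    obtain ⟨-, l1, l2, l3, l4⟩ := hh
    simp [Matrix.mul_apply, Fin.sum_univ_four, *]
  inv_mem' := by
    rintro g ⟨hg, h1, h2⟩
    obtain ⟨μ, hμ⟩ := mem_GSp4_iff.1 hg.1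
    refine ⟨inv_mem hg, ?_⟩
    rw [GSp4_inv_val hμ]
    simp [*]

variable {R}

theorem s1_mem_siegelLevi : s1 R ∈ siegelLevi R := by
  refine ⟨⟨⟨1, ?_⟩, ?_⟩, ?_⟩
  · ext i j; fin_cases i <;> fin_cases j <;>
      simp [s1, formJ, block4, Matrix.mul_apply, Fin.sum_univ_four]
  all_goals simp [s1]

theorem unipW_mem_siegelLevi (w : R) : unipW w ∈ siegelLevi R := by
  refine ⟨⟨⟨1, ?_⟩, ?_⟩, ?_⟩
  · ext i j; fin_cases i <;> fin_cases j <;>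
      simp [unipW, formJ, block4, Matrix.mul_apply, Fin.sum_univ_four]
  all_goals simp [unipW]

theorem s2_mem_GSp4 : s2 R ∈ GSp4 R := by
  refine ⟨1, ?_⟩
  ext i j; fin_cases i <;> fin_cases j <;>
    simp [s2, formJ, block4, Matrix.mul_apply, Fin.sum_univ_four]

theorem unipW_mem_borel (w : R) : unipW w ∈ borel R :=
  ⟨(unipW_mem_siegelLevi w).1, by simp [unipW], by simp [unipW]⟩

variable (R)

/-- The elements `1, s₂, s₂s₁, s₂s₁s₂` of `W⁽¹⁾`, in order of increasing length. -/
def weylOneElt : Fin 4 → GL (Fin 4) R :=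
  ![1, s2 R, s2 R * s1 R, s2 R * s1 R * s2 R]

variable {R}

theorem weylOneElt_mem_GSp4 (i : Fin 4) : weylOneElt R i ∈ GSp4 R := by
  have h1 : s1 R ∈ GSp4 R := s1_mem_siegelLevi.1.1
  have h2 : s2 R ∈ GSp4 R := s2_mem_GSp4
  fin_cases i
  exacts [one_mem _, h2, mul_mem h2 h1, mul_mem (mul_mem h2 h1) h2]

/-- Representatives of the lines in `R²`: `none` stands for the line spanned by `(0, 1)`, and
`some w` for the one spanned by `(1, w)`. -/
def lineElt : Option R → GL (Fin 4) R
  | none => 1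
  | some w => unipW w * s1 R

theorem lineElt_mem_siegelLevi (o : Option R) : lineElt o ∈ siegelLevi R := by
  cases o with
  | none => exact one_mem _
  | some w => exact mul_mem (unipW_mem_siegelLevi w) s1_mem_siegelLevi

end Symplectic

/-! ### The Bessel subgroup in coordinates -/

section Bessel

variable {R : Type*} [CommRing R]

/-- The element of `U(R)` given by the symmetric matrix with rows `(p, q)` and `(q, r)`. -/
def unipElt (p q r : R) : GL (Fin 4) R where
  val := !![1, 0, p, q; 0, 1, q, r; 0, 0, 1, 0; 0, 0, 0, 1]
  inv := !![1, 0, -p, -q; 0, 1, -q, -r; 0, 0, 1, 0; 0, 0, 0, 1]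
  val_inv := by
    ext i j; fin_cases i <;> fin_cases j <;> simp [Matrix.mul_apply, Fin.sum_univ_four]
  inv_val := by
    ext i j; fin_cases i <;> fin_cases j <;> simp [Matrix.mul_apply, Fin.sum_univ_four]

theorem unipElt_mem_siegelParabolic (p q r : R) : unipElt p q r ∈ siegelParabolic R := by
  refine ⟨⟨1, ?_⟩, by simp [unipElt]⟩
  ext i j; fin_cases i <;> fin_cases j <;>
    simp [unipElt, formJ, block4, Matrix.mul_apply, Fin.sum_univ_four]

theorem unipElt_mem_borel (p q r : R) : unipElt p q r ∈ borel R :=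
  ⟨unipElt_mem_siegelParabolic p q r, by simp [unipElt], by simp [unipElt]⟩

/-- The block diagonal element with blocks `A` and `det(A) ᵗA⁻¹`, where
`A = x + y (b, c ; -a, 0)` has the invertible determinant `u`. -/
def torusElt (a b c x y : R) (u : Rˣ) (hu : (u : R) = x ^ 2 + b * x * y + a * c * y ^ 2) :
    GL (Fin 4) R where
  val := !![x + y * b, y * c, 0, 0; -(y * a), x, 0, 0; 0, 0, x, y * a; 0, 0, -(y * c), x + y * b]
  inv := ((u⁻¹ : Rˣ) : R) •
    !![x, -(y * c), 0, 0; y * a, x + y * b, 0, 0; 0, 0, x + y * b, -(y * a); 0, 0, y * c, x]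
  val_inv := by
    rw [Matrix.mul_smul, ← Units.smul_def, inv_smul_eq_iff, Units.smul_def, hu]
    ext i j; fin_cases i <;> fin_cases j <;> simp [Matrix.mul_apply, Fin.sum_univ_four] <;> ring
  inv_val := by
    rw [Matrix.smul_mul, ← Units.smul_def, inv_smul_eq_iff, Units.smul_def, hu]
    ext i j; fin_cases i <;> fin_cases j <;> simp [Matrix.mul_apply, Fin.sum_univ_four] <;> ring

theorem torusElt_mem_siegelLevi (a b c x y : R) (u : Rˣ)
    (hu : (u : R) = x ^ 2 + b * x * y + a * c * y ^ 2) :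
    torusElt a b c x y u hu ∈ siegelLevi R := by
  refine ⟨⟨⟨u, ?_⟩, by simp [torusElt]⟩, by simp [torusElt]⟩
  rw [hu]
  ext i j; fin_cases i <;> fin_cases j <;>
    simp [torusElt, formJ, block4, Matrix.mul_apply, Fin.sum_univ_four] <;> ring

/-- The Bessel subgroup `T(R) U(R)`, described by the entries of its elements: a symplectic
similitude with blocks `A, B, 0, D` belongs to it if `A = x + y (b, c ; -a, 0)` and
`D = adj(A)ᵀ`. -/
def besselSubgroup (a b c : R) : Subgroup (GL (Fin 4) R) where
  carrier := {g | g ∈ siegelParabolic R ∧ ∃ x y : R,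
    (g.val 0 0 = x + y * b ∧ g.val 0 1 = y * c ∧ g.val 1 0 = -(y * a) ∧ g.val 1 1 = x) ∧
    (g.val 2 2 = x ∧ g.val 2 3 = y * a ∧ g.val 3 2 = -(y * c) ∧ g.val 3 3 = x + y * b)}
  one_mem' := ⟨one_mem _, 1, 0, by simp⟩
  mul_mem' := by
    rintro g g' ⟨hg, x, y, ⟨h1, h2, h3, h4⟩, h5, h6, h7, h8⟩
      ⟨hg', x', y', ⟨k1, k2, k3, k4⟩, k5, k6, k7, k8⟩
    refine ⟨mul_mem hg hg', x * x' - a * c * y * y', x * y' + x' * y + b * y * y', ?_⟩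
    obtain ⟨-, g1, g2, g3, g4⟩ := hg
    obtain ⟨-, l1, l2, l3, l4⟩ := hg'
    refine ⟨⟨?_, ?_, ?_, ?_⟩, ?_, ?_, ?_, ?_⟩ <;>
      simp [Matrix.mul_apply, Fin.sum_univ_four, *] <;> ring
  inv_mem' := by
    rintro g ⟨hg, x, y, ⟨h1, h2, h3, h4⟩, h5, h6, h7, h8⟩
    obtain ⟨μ, hμ⟩ := mem_GSp4_iff.1 hg.1
    refine ⟨inv_mem hg, ((μ⁻¹ : Rˣ) : R) * (x + y * b), -((μ⁻¹ : Rˣ) : R) * y, ?_⟩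
    rw [GSp4_inv_val hμ]
    refine ⟨⟨?_, ?_, ?_, ?_⟩, ?_, ?_, ?_, ?_⟩ <;> simp [*] <;> ring

theorem torusElt_mem_besselSubgroup (a b c x y : R) (u : Rˣ)
    (hu : (u : R) = x ^ 2 + b * x * y + a * c * y ^ 2) :
    torusElt a b c x y u hu ∈ besselSubgroup a b c :=
  ⟨(torusElt_mem_siegelLevi a b c x y u hu).1, x, y, by simp [torusElt]⟩

theorem unipElt_mem_besselSubgroup (a b c p q r : R) : unipElt p q r ∈ besselSubgroup a b c :=
  ⟨unipElt_mem_siegelParabolic p q r, 1, 0, by simp [unipElt]⟩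

/-- The vanishing of the lower left block makes the determinant of the upper left one a unit. -/
theorem isUnit_det_of_mem_siegelParabolic {g : GL (Fin 4) R} (hg : g ∈ siegelParabolic R) :
    IsUnit (g.val 0 0 * g.val 1 1 - g.val 0 1 * g.val 1 0) ∧
      IsUnit (g.val 2 2 * g.val 3 3 - g.val 2 3 * g.val 3 2) := by
  have h1 : IsUnit g.val.det := (Matrix.isUnit_iff_isUnit_det _).1 g.isUnit
  rw [det_eq_of_lowerLeft hg.2.1 hg.2.2.1 hg.2.2.2.1 hg.2.2.2.2] at h1
  exact IsUnit.mul_iff.1 h1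

/-- A symplectic similitude with diagonal blocks `1` lies in the unipotent radical. -/
theorem exists_eq_unipElt {g : GL (Fin 4) R} (hg : g ∈ siegelParabolic R)
    (h1 : g.val 0 0 = 1 ∧ g.val 0 1 = 0 ∧ g.val 1 0 = 0 ∧ g.val 1 1 = 1)
    (h2 : g.val 2 2 = 1 ∧ g.val 2 3 = 0 ∧ g.val 3 2 = 0 ∧ g.val 3 3 = 1) :
    ∃ p q r : R, g = unipElt p q r := by
  obtain ⟨⟨μ, hμ⟩, g1, g2, g3, g4⟩ := hg
  obtain ⟨a1, a2, a3, a4⟩ := h1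
  obtain ⟨d1, d2, d3, d4⟩ := h2
  have e := congrFun (congrFun hμ 2) 3
  simp [formJ, block4, Matrix.mul_apply, Fin.sum_univ_four, *] at e
  refine ⟨g.val 0 2, g.val 0 3, g.val 1 3, ?_⟩
  ext i j; fin_cases i <;> fin_cases j <;> simp [unipElt, *]
  linear_combination e

section Field

variable {F : Type*} [Field F]

/-- For `c ≠ 0` the torus `T(F)` consists of the invertible matrices `x + y (b, c ; -a, 0)`. -/
theorem mem_torusT_iff [NeZero (2 : F)] {a b c : F} (hc : c ≠ 0) {g : GL (Fin 2) F} :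
    g ∈ torusT a b c ↔ ∃ x y : F, g.val = !![x + y * b, y * c; -(y * a), x] := by
  have h2 : (2 : F) ≠ 0 := two_ne_zero
  constructor
  · intro h
    have h0 : g.val.transpose * matS a b c * g.val = g.val.det • matS a b c := h
    have hdet : g.val.det ≠ 0 := ((Matrix.isUnit_iff_isUnit_det _).1 g.isUnit).ne_zero
    -- multiplying the defining equation by `adj g` makes it linear in `g`
    have h1 : g.val.transpose * matS a b c = matS a b c * g.val.adjugate := by
      have := congrArg (fun M => M * g.val.adjugate) h0
      simp only [Matrix.mul_assoc, Matrix.mul_adjugate, Matrix.smul_mul, Matrix.mul_smul,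
        Matrix.mul_one] at this
      exact smul_right_injective _ hdet this
    have e01 := congrFun (congrFun h1 0) 1
    have e11 := congrFun (congrFun h1 1) 1
    simp only [matS, Matrix.mul_apply, Fin.sum_univ_two, Matrix.adjugate_fin_two,
      Matrix.transpose_apply, Matrix.of_apply, Matrix.cons_val', Matrix.cons_val_zero,
      Matrix.cons_val_one, Matrix.cons_val_fin_one] at e01 e11
    refine ⟨g.val 1 1, g.val 0 1 / c, ?_⟩
    ext i j; fin_cases i <;> fin_cases j <;> simp
    · field_simp at e11 ⊢
      exact mul_left_cancel₀ h2 (by linear_combination -e11)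
    · field_simp
    · field_simp at e01 ⊢
      exact mul_left_cancel₀ h2 (by linear_combination e01)
  · rintro ⟨x, y, h⟩
    change g.val.transpose * matS a b c * g.val = g.val.det • matS a b c
    rw [h]
    ext i j; fin_cases i <;> fin_cases j <;>
      simp [matS, Matrix.mul_apply, Fin.sum_univ_two, Matrix.det_fin_two] <;> field_simp <;> ring

theorem coe_besselSubgroup [NeZero (2 : F)] {a b c : F} (hc : c ≠ 0) :
    (besselSubgroup a b c : Set (GL (Fin 4) F)) = besselR a b c := by
  ext g
  constructor
  · intro hg
    obtain ⟨hgP, x, y, ⟨h1, h2, h3, h4⟩, h5, h6, h7, h8⟩ := id hg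
    have hN := (isUnit_det_of_mem_siegelParabolic hgP).1
    rw [h1, h2, h3, h4] at hN
    have hA : IsUnit (!![x + y * b, y * c; -(y * a), x] : Matrix (Fin 2) (Fin 2) F) := by
      rw [Matrix.isUnit_iff_isUnit_det, Matrix.det_fin_two]
      exact hN
    obtain ⟨A, hA⟩ := hA
    obtain ⟨u, hu⟩ := hN
    have hdet : A.val.det ≠ 0 := ((Matrix.isUnit_iff_isUnit_det _).1 A.isUnit).ne_zero
    have hu' : (u : F) = x ^ 2 + b * x * y + a * c * y ^ 2 := by rw [hu]; ring
    set t := torusElt a b c x y u hu' with ht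
    have htinv : (t⁻¹).val = ((u⁻¹ : Fˣ) : F) • !![x, -(y * c), 0, 0; y * a, x + y * b, 0, 0;
      0, 0, x + y * b, -(y * a); 0, 0, y * c, x] := rfl
    have huu : ((u⁻¹ : Fˣ) : F) * (x ^ 2 + b * x * y + a * c * y ^ 2) = 1 := by
      rw [← hu', Units.inv_mul]
    obtain ⟨p, q, r, hpqr⟩ : ∃ p q r : F, t⁻¹ * g = unipElt p q r := by
      obtain ⟨-, g1, g2, g3, g4⟩ := hgP
      apply exists_eq_unipElt (mul_mem (inv_mem (torusElt_mem_siegelLevi a b c x y u hu').1) hg.1)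
      · rw [Units.val_mul, htinv]
        refine ⟨?_, ?_, ?_, ?_⟩ <;>
          simp only [Matrix.mul_apply, Fin.sum_univ_four, h1, h2, h3, h4, g1, g2, g3, g4] <;>
          simp [-Units.val_inv_eq_inv_val]
        · linear_combination huu
        · ring
        · ring
        · linear_combination huu
      · rw [Units.val_mul, htinv]
        refine ⟨?_, ?_, ?_, ?_⟩ <;>
          simp only [Matrix.mul_apply, Fin.sum_univ_four, h5, h6, h7, h8] <;>
          simp [-Units.val_inv_eq_inv_val]
        · linear_combination huu
        · ring
        · ring
        · linear_combination huu
    refine ⟨t, ⟨A, (mem_torusT_iff hc).2 ⟨x, y, hA⟩, ?_⟩,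
      t⁻¹ * g, ⟨!![p, q; q, r], ?_, ?_⟩, by group⟩
    · rw [Matrix.coe_units_inv, Matrix.inv_def, Matrix.transpose_smul, smul_smul,
        Ring.mul_inverse_cancel _ hdet.isUnit, one_smul, Matrix.adjugate_fin_two, hA]
      ext i j; fin_cases i <;> fin_cases j <;> simp [ht, torusElt, block4]
    · ext i j; fin_cases i <;> fin_cases j <;> simp
    · rw [hpqr]
      ext i j; fin_cases i <;> fin_cases j <;> simp [unipElt, block4]
  · rintro ⟨t, ⟨A, hA, ht⟩, u, ⟨X, hX, hu⟩, rfl⟩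
    obtain ⟨x, y, hA'⟩ := (mem_torusT_iff hc).1 hA
    have hdet : IsUnit A.val.det := (Matrix.isUnit_iff_isUnit_det _).1 A.isUnit
    have hX' : X 1 0 = X 0 1 := congrFun (congrFun hX 0) 1
    rw [Matrix.coe_units_inv, Matrix.inv_def, Matrix.transpose_smul, smul_smul,
      Ring.mul_inverse_cancel _ hdet, one_smul, Matrix.adjugate_fin_two, hA'] at ht
    rw [hA', Matrix.det_fin_two] at hdet
    obtain ⟨v, hv⟩ := hdet
    have hv' : (v : F) = x ^ 2 + b * x * y + a * c * y ^ 2 := by rw [hv]; simp; ring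
    have ht' : t = torusElt a b c x y v hv' := by
      ext i j
      rw [ht]
      fin_cases i <;> fin_cases j <;> simp [torusElt, block4]
    have hu' : u = unipElt (X 0 0) (X 0 1) (X 1 1) := by
      ext i j
      rw [hu]
      fin_cases i <;> fin_cases j <;> simp [unipElt, block4, hX']
    rw [ht', hu']
    exact mul_mem (torusElt_mem_besselSubgroup ..) (unipElt_mem_besselSubgroup ..)

end Field

end Bessel

/-! ### Double cosets of the Bessel subgroup over a field -/

section ResidueField

theorem s1_inv_val (R : Type*) [CommRing R] :
    ((s1 R)⁻¹).val = !![0, 1, 0, 0; 1, 0, 0, 0; 0, 0, 0, 1; 0, 0, 1, 0] := rfl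

theorem s2_inv_val (R : Type*) [CommRing R] :
    ((s2 R)⁻¹).val = !![0, 0, -1, 0; 0, 1, 0, 0; 1, 0, 0, 0; 0, 0, 0, 1] := rfl

variable {k : Type*} [Field k]

/-- The last two rows of a symplectic similitude are orthogonal for the symplectic form. -/
theorem lowerRows_isotropic {g : GL (Fin 4) k} (hg : g ∈ GSp4 k) :
    g.val 2 0 * g.val 3 2 + g.val 2 1 * g.val 3 3 =
      g.val 2 2 * g.val 3 0 + g.val 2 3 * g.val 3 1 := by
  obtain ⟨μ, hμ⟩ := hg
  have e := congrFun (congrFun (mul_formJ_mul_transpose hμ) 2) 3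
  simp [formJ, block4, Matrix.mul_apply, Fin.sum_univ_four] at e
  linear_combination e

/-- The cell of `s₂`: the second column of `g` lies in the span of the first two basis vectors,
but the first one does not. -/
theorem exists_mul_s2_mem_siegelParabolic {g : GL (Fin 4) k} (hg : g ∈ GSp4 k)
    (h21 : g.val 2 1 = 0) (h31 : g.val 3 1 = 0) (h0 : ¬ (g.val 2 0 = 0 ∧ g.val 3 0 = 0)) :
    ∃ t : k, g * unipElt t 0 0 * (s2 k)⁻¹ ∈ siegelParabolic k := by
  have hiso := lowerRows_isotropic hg
  rw [h21, h31, zero_mul, mul_zero, add_zero, add_zero] at hiso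
  obtain ⟨t, ht2, ht3⟩ : ∃ t : k, g.val 2 0 * t + g.val 2 2 = 0 ∧ g.val 3 0 * t + g.val 3 2 = 0 := by
    by_cases h20 : g.val 2 0 = 0
    · have h30 : g.val 3 0 ≠ 0 := fun h => h0 ⟨h20, h⟩
      refine ⟨-g.val 3 2 / g.val 3 0, ?_, ?_⟩ <;> field_simp
      · linear_combination -hiso
      · ring
    · refine ⟨-g.val 2 2 / g.val 2 0, ?_, ?_⟩ <;> field_simp
      · ring
      · linear_combination hiso
  refine ⟨t, mul_mem (mul_mem hg (unipElt_mem_siegelParabolic t 0 0).1) (inv_mem s2_mem_GSp4), ?_⟩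
  rw [Units.val_mul, s2_inv_val]
  simp [unipElt, Matrix.mul_apply, Fin.sum_univ_four, h21, h31, ht2, ht3]

/-- The Bruhat decomposition of `GSp₄` with respect to the Siegel parabolic subgroup. -/
theorem exists_mul_weylOneElt_inv_mem {g : GL (Fin 4) k} (hg : g ∈ GSp4 k) :
    ∃ i, ∃ β ∈ borel k, g * β * (weylOneElt k i)⁻¹ ∈ siegelParabolic k := by
  have hiso := lowerRows_isotropic hg
  by_cases h1 : g.val 2 1 = 0 ∧ g.val 3 1 = 0
  · by_cases h0 : g.val 2 0 = 0 ∧ g.val 3 0 = 0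
    · exact ⟨0, 1, one_mem _, by simpa [weylOneElt] using ⟨hg, h0.1, h1.1, h0.2, h1.2⟩⟩
    · obtain ⟨t, ht⟩ := exists_mul_s2_mem_siegelParabolic hg h1.1 h1.2 h0
      exact ⟨1, _, unipElt_mem_borel t 0 0, ht⟩
  by_cases hdet : g.val 2 0 * g.val 3 1 - g.val 2 1 * g.val 3 0 = 0
  · obtain ⟨w, hw2, hw3⟩ : ∃ w : k, g.val 2 0 + g.val 2 1 * w = 0 ∧
        g.val 3 0 + g.val 3 1 * w = 0 := by
      by_cases h21 : g.val 2 1 = 0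
      · have h31 : g.val 3 1 ≠ 0 := fun h => h1 ⟨h21, h⟩
        refine ⟨-g.val 3 0 / g.val 3 1, ?_, ?_⟩ <;> field_simp
        · linear_combination hdet
        · ring
      · refine ⟨-g.val 2 0 / g.val 2 1, ?_, ?_⟩ <;> field_simp
        · ring
        · linear_combination -hdet
    -- after this column operation, exchanging the first two columns leads to the cell of `s₂`
    have hs1 : s1 k ∈ GSp4 k := s1_mem_siegelLevi.1.1
    have hg' : g * unipW w * s1 k ∈ GSp4 k :=
      mul_mem (mul_mem hg (unipW_mem_siegelLevi w).1.1) hs1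
    obtain ⟨t, ht⟩ := exists_mul_s2_mem_siegelParabolic hg'
      (by simp [unipW, s1, Matrix.mul_apply, Fin.sum_univ_four, hw2])
      (by simp [unipW, s1, Matrix.mul_apply, Fin.sum_univ_four, hw3])
      (by simpa [unipW, s1, Matrix.mul_apply, Fin.sum_univ_four] using h1)
    refine ⟨2, unipW w * unipElt 0 0 t,
      mul_mem (unipW_mem_borel w) (unipElt_mem_borel 0 0 t), ?_⟩
    have hcomm : unipElt 0 0 t * (s1 k)⁻¹ = s1 k * unipElt t 0 0 := by
      ext i j
      rw [Units.val_mul, s1_inv_val]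
      fin_cases i <;> fin_cases j <;>
        simp [unipElt, s1, Matrix.mul_apply, Fin.sum_univ_four]
    have heq : g * (unipW w * unipElt 0 0 t) * (weylOneElt k 2)⁻¹ =
        g * unipW w * s1 k * unipElt t 0 0 * (s2 k)⁻¹ := by
      have := congrArg (fun z => g * unipW w * z * (s2 k)⁻¹) hcomm
      simpa [weylOneElt, mul_inv_rev, mul_assoc] using this
    rw [heq]
    exact ht
  · -- the big cell: `X = -C⁻¹ D` is symmetric because the lower two rows of `g` are isotropic
    obtain ⟨Δ, hΔ⟩ : ∃ Δ, Δ = g.val 2 0 * g.val 3 1 - g.val 2 1 * g.val 3 0 := ⟨_, rfl⟩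
    rw [← hΔ] at hdet
    refine ⟨3, unipElt ((g.val 2 1 * g.val 3 2 - g.val 3 1 * g.val 2 2) / Δ)
      ((g.val 3 0 * g.val 2 2 - g.val 2 0 * g.val 3 2) / Δ)
      ((g.val 3 0 * g.val 2 3 - g.val 2 0 * g.val 3 3) / Δ), unipElt_mem_borel _ _ _,
      mul_mem (mul_mem hg (unipElt_mem_siegelParabolic _ _ _).1)
        (inv_mem (weylOneElt_mem_GSp4 3)), ?_⟩
    have hinv : ((weylOneElt k 3)⁻¹).val =
        !![0, 0, 0, -1; 0, 0, -1, 0; 0, 1, 0, 0; 1, 0, 0, 0] := by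
      change ((s2 k * s1 k * s2 k)⁻¹).val = _
      rw [mul_inv_rev, mul_inv_rev, Units.val_mul, Units.val_mul, s1_inv_val, s2_inv_val]
      ext i j; fin_cases i <;> fin_cases j <;>
        simp [Matrix.mul_apply, Fin.sum_univ_four]
    rw [Units.val_mul, hinv]
    refine ⟨?_, ?_, ?_, ?_⟩ <;>
      simp only [unipElt, Units.val_mul, Matrix.mul_apply, Fin.sum_univ_four] <;> simp <;>
      field_simp
    · linear_combination g.val 2 3 * hΔ - g.val 2 0 * hiso
    · linear_combination g.val 2 2 * hΔ
    · linear_combination g.val 3 3 * hΔ - g.val 3 0 * hiso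
    · linear_combination g.val 3 2 * hΔ

/-- An element of the Siegel parabolic subgroup can be brought into the Levi subgroup by an element
of the unipotent radical. -/
theorem exists_unipElt_mul_mem_siegelLevi {g : GL (Fin 4) k} (hg : g ∈ siegelParabolic k) :
    ∃ p q r : k, (unipElt p q r)⁻¹ * g ∈ siegelLevi k := by
  have hD := (isUnit_det_of_mem_siegelParabolic hg).2.ne_zero
  obtain ⟨g20, g21, g30, g31⟩ := hg.2
  obtain ⟨μ, hμ⟩ := hg.1
  have e := congrFun (congrFun hμ 2) 3
  simp [formJ, block4, Matrix.mul_apply, Fin.sum_univ_four] at e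
  set Δ := g.val 2 2 * g.val 3 3 - g.val 2 3 * g.val 3 2 with hΔ
  -- `X = B D⁻¹`
  have hval : ∀ p q r : k, ((unipElt p q r)⁻¹).val =
    !![1, 0, -p, -q; 0, 1, -q, -r; 0, 0, 1, 0; 0, 0, 0, 1] := fun _ _ _ => rfl
  refine ⟨(g.val 0 2 * g.val 3 3 - g.val 0 3 * g.val 3 2) / Δ,
    (g.val 0 3 * g.val 2 2 - g.val 0 2 * g.val 2 3) / Δ,
    (g.val 1 3 * g.val 2 2 - g.val 1 2 * g.val 2 3) / Δ,
    mul_mem (inv_mem (unipElt_mem_siegelParabolic _ _ _)) hg, ?_⟩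
  rw [Units.val_mul, hval]
  refine ⟨?_, ?_, ?_, ?_⟩ <;> simp [Matrix.mul_apply, Fin.sum_univ_four] <;> field_simp <;>
    rw [hΔ]
  · ring
  · ring
  · linear_combination g.val 2 2 * e
  · linear_combination g.val 2 3 * e

/-- In a Levi element with blocks `A` and `D`, the block `D` is a multiple of `ᵗA⁻¹`, so it is upper
triangular if `A` is lower triangular. -/
theorem mem_borel_of_mem_siegelLevi {g : GL (Fin 4) k} (hg : g ∈ siegelLevi k)
    (h01 : g.val 0 1 = 0) : g ∈ borel k := by
  refine ⟨hg.1, h01, ?_⟩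
  have hA := (isUnit_det_of_mem_siegelParabolic hg.1).1.ne_zero
  obtain ⟨⟨⟨μ, hμ⟩, g20, g21, g30, g31⟩, -⟩ := hg
  have e := congrFun (congrFun hμ 1) 2
  simp [formJ, block4, Matrix.mul_apply, Fin.sum_univ_four, *] at e
  rw [h01, zero_mul, sub_zero] at hA
  exact e.resolve_left (right_ne_zero_of_mul hA)

/-- Since the elements of `W⁽¹⁾` have minimal length in their cosets, they conjugate the Borel
subgroup of the Levi subgroup into the Borel subgroup of `GSp₄`. -/
theorem weylOneElt_inv_mul_mul_mem_borel {g : GL (Fin 4) k} (hg : g ∈ siegelLevi k)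
    (h01 : g.val 0 1 = 0) (i : Fin 4) :
    (weylOneElt k i)⁻¹ * g * weylOneElt k i ∈ borel k := by
  have h32 := (mem_borel_of_mem_siegelLevi hg h01).2.2
  have hw := weylOneElt_mem_GSp4 (R := k) i
  have hG : (weylOneElt k i)⁻¹ * g * weylOneElt k i ∈ GSp4 k :=
    mul_mem (mul_mem (inv_mem hw) hg.1.1) hw
  obtain ⟨⟨-, g1, g2, g3, g4⟩, g5, g6, g7, g8⟩ := hg
  refine ⟨⟨hG, ?_⟩, ?_⟩ <;> clear hG hw <;> fin_cases i <;>
    simp [weylOneElt, mul_inv_rev, Units.val_mul, s1, s2,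
      -Matrix.coe_units_inv, Matrix.mul_apply, Matrix.vecMul, dotProduct, Fin.sum_univ_four, *]

/-- A line in `k²` either is moved by the torus to the line spanned by `(0, 1)`, or it is spanned
by `(1, w)` with `c w² + b w + a = 0`. -/
theorem exists_eq_torusElt_mul_lineElt (a b : k) {c : k} (hc : c ≠ 0) {g : GL (Fin 4) k}
    (hg : g ∈ siegelLevi k) :
    ∃ x y u hu, ∃ o : Option k, (∀ w, o = some w → c * w ^ 2 + b * w + a = 0) ∧
      ∃ m ∈ siegelLevi k, m.val 0 1 = 0 ∧ g = torusElt a b c x y u hu * lineElt o * m := by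
  have hA := (isUnit_det_of_mem_siegelParabolic hg.1).1.ne_zero
  by_cases hv : c * g.val 1 1 ^ 2 + b * g.val 0 1 * g.val 1 1 + a * g.val 0 1 ^ 2 = 0
  · have h0 : g.val 0 1 ≠ 0 := by
      intro h
      rw [h] at hv hA
      have : g.val 1 1 = 0 := by simpa [hc] using hv
      simp [this] at hA
    have h1 : torusElt a b c 1 0 1 (by simp) = 1 := by
      ext i j; fin_cases i <;> fin_cases j <;> simp [torusElt]
    refine ⟨1, 0, 1, by simp, some (g.val 1 1 / g.val 0 1), ?_,
      (lineElt (some (g.val 1 1 / g.val 0 1)))⁻¹ * g,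
      mul_mem (inv_mem (lineElt_mem_siegelLevi _)) hg, ?_, by rw [h1]; group⟩
    · rintro w ⟨⟩
      field_simp
      linear_combination hv
    · have hval : ∀ w : k, ((unipW w)⁻¹).val =
        !![1, 0, 0, 0; -w, 1, 0, 0; 0, 0, 1, w; 0, 0, 0, 1] := fun _ => rfl
      rw [lineElt, mul_inv_rev, Units.val_mul, Units.val_mul, s1_inv_val, hval]
      simp [Matrix.mul_apply, Fin.sum_univ_four]
      field_simp
      ring
  · have hN : g.val 1 1 ^ 2 + b * g.val 1 1 * (g.val 0 1 / c) + a * c * (g.val 0 1 / c) ^ 2 ≠ 0 := by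
      intro h
      apply hv
      field_simp at h
      linear_combination h
    set t := torusElt a b c (g.val 1 1) (g.val 0 1 / c) (Units.mk0 _ hN) rfl with ht
    have htinv : (t⁻¹).val = ((Units.mk0 _ hN)⁻¹ : kˣ).val •
      !![g.val 1 1, -(g.val 0 1 / c * c), 0, 0;
        g.val 0 1 / c * a, g.val 1 1 + g.val 0 1 / c * b, 0, 0;
        0, 0, g.val 1 1 + g.val 0 1 / c * b, -(g.val 0 1 / c * a);
        0, 0, g.val 0 1 / c * c, g.val 1 1] := rfl
    refine ⟨_, _, _, _, none, by simp, t⁻¹ * g,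
      mul_mem (inv_mem (torusElt_mem_siegelLevi ..)) hg, ?_,
      show g = t * lineElt none * (t⁻¹ * g) by simp [lineElt]⟩
    obtain ⟨⟨-, g20, g21, g30, g31⟩, -⟩ := hg
    rw [Units.val_mul, htinv]
    simp [Matrix.mul_apply, Fin.sum_univ_four, g21, g31, hc]
    ring

/-- Every element of `GSp₄` lies in one of the double cosets. -/
theorem exists_eq_bessel_mul_borel (a b : k) {c : k} (hc : c ≠ 0) {g : GL (Fin 4) k}
    (hg : g ∈ GSp4 k) :
    ∃ p q r x y u hu, ∃ o : Option k, (∀ w, o = some w → c * w ^ 2 + b * w + a = 0) ∧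
      ∃ i, ∃ β ∈ borel k,
        g = unipElt p q r * torusElt a b c x y u hu * (lineElt o * weylOneElt k i) * β := by
  obtain ⟨i, β, hβ, hp⟩ := exists_mul_weylOneElt_inv_mem hg
  obtain ⟨p, q, r, hm'⟩ := exists_unipElt_mul_mem_siegelLevi hp
  obtain ⟨x, y, u, hu, o, ho, m, hm, h01, heq⟩ := exists_eq_torusElt_mul_lineElt a b hc hm'
  refine ⟨p, q, r, x, y, u, hu, o, ho, i,
    (weylOneElt k i)⁻¹ * m * weylOneElt k i * β⁻¹,
    mul_mem (weylOneElt_inv_mul_mul_mem_borel hm h01 i) (inv_mem hβ), ?_⟩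
  rw [inv_mul_eq_iff_eq_mul, mul_inv_eq_iff_eq_mul, ← eq_mul_inv_iff_mul_eq] at heq
  rw [heq]
  group

set_option maxHeartbeats 1000000 in
/-- The four cells of the Bruhat decomposition are disjoint, and the stabilizer in the Siegel
parabolic subgroup of the base point of each of them maps into the Borel subgroup of the Levi
quotient. -/
theorem eq_and_apply_eq_zero_of_mem_borel {g : GL (Fin 4) k} (hg : g ∈ siegelParabolic k)
    {i j : Fin 4} (h : (weylOneElt k i)⁻¹ * g * weylOneElt k j ∈ borel k) :
    i = j ∧ g.val 0 1 = 0 := by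
  obtain ⟨hA, hD⟩ := isUnit_det_of_mem_siegelParabolic hg
  replace hA := hA.ne_zero
  replace hD := hD.ne_zero
  obtain ⟨-, g20, g21, g30, g31⟩ := hg
  obtain ⟨⟨-, h20, h21, h30, h31⟩, h01, h32⟩ := h
  fin_cases i <;> fin_cases j <;>
    simp [weylOneElt, mul_inv_rev, Units.val_mul, s1, s2,
      -Matrix.coe_units_inv, Matrix.mul_apply, Matrix.vecMul, dotProduct, Fin.sum_univ_four]
      at h20 h21 h30 h31 h01 h32 ⊢ <;> simp_all

/-- The double cosets in `exists_eq_bessel_mul_borel` are disjoint: the torus acts transitively on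
the lines outside the zeros of the quadratic form, and fixes its zeros. -/
theorem eq_of_mem_borel {a b c : k} {g : GL (Fin 4) k} (hg : g ∈ siegelParabolic k)
    {x y : k} (h00 : g.val 0 0 = x + y * b) (h01 : g.val 0 1 = y * c)
    (h10 : g.val 1 0 = -(y * a)) (h11 : g.val 1 1 = x) {o o' : Option k}
    (ho : ∀ w, o = some w → c * w ^ 2 + b * w + a = 0)
    (ho' : ∀ w, o' = some w → c * w ^ 2 + b * w + a = 0) {i j : Fin 4}
    (h : (lineElt o * weylOneElt k i)⁻¹ * g * (lineElt o' * weylOneElt k j) ∈ borel k) :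
    o = o' ∧ i = j := by
  have hN := (isUnit_det_of_mem_siegelParabolic hg).1.ne_zero
  rw [h00, h01, h10, h11] at hN
  -- at a zero `w`, the determinant of `A` is the product of its eigenvalue `x + y b + y c w` on
  -- the line spanned by `(1, w)` and of the other eigenvalue `x - y c w`
  have key : ∀ w, c * w ^ 2 + b * w + a = 0 → x ≠ w * (y * c) := by
    rintro w hw rfl
    apply hN
    linear_combination y ^ 2 * c * hw
  have key' : ∀ w, c * w ^ 2 + b * w + a = 0 → x + y * b + y * c * w ≠ 0 := by
    intro w hw hx
    apply hN
    linear_combination (x - y * c * w) * hx + y ^ 2 * c * hw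
  have hP : (lineElt o)⁻¹ * g * lineElt o' ∈ siegelParabolic k :=
    mul_mem (mul_mem (inv_mem (lineElt_mem_siegelLevi o).1) hg) (lineElt_mem_siegelLevi o').1
  obtain ⟨rfl, h0⟩ := eq_and_apply_eq_zero_of_mem_borel hP (i := i) (j := j)
    (by simpa [mul_inv_rev, mul_assoc] using h)
  refine ⟨?_, rfl⟩
  obtain ⟨-, g20, g21, g30, g31⟩ := hg
  cases o with
  | none =>
    cases o' with
    | none => rfl
    | some w =>
      simp [lineElt, unipW, s1, Matrix.mul_apply, Fin.sum_univ_four, h00, h01] at h0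
      exact absurd h0 (key' w (ho' w rfl))
  | some w =>
    cases o' with
    | none =>
      simp [lineElt, mul_inv_rev, unipW, s1, Matrix.mul_apply, Fin.sum_univ_four,
        -Matrix.coe_units_inv, *] at h0
      exact absurd (by linear_combination h0) (key w (ho w rfl))
    | some w' =>
      simp [lineElt, mul_inv_rev, unipW, s1, Matrix.mul_apply, Matrix.vecMul,
        dotProduct, Fin.sum_univ_four, -Matrix.coe_units_inv, *] at h0
      have h1 : (w' - w) * (x - w * (y * c)) = 0 := by
        linear_combination h0 + y * ho w rfl
      rcases mul_eq_zero.1 h1 with h2 | h2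
      · rw [sub_eq_zero.1 h2]
      · exact absurd (sub_eq_zero.1 h2) (key w (ho w rfl))

end ResidueField

/-! ### Base change -/

section Map

variable {R S : Type*} [CommRing R] [CommRing S] (f : R →+* S)

theorem map_mem_GSp4 {g : GL (Fin 4) R} (hg : g ∈ GSp4 R) :
    Matrix.GeneralLinearGroup.map f g ∈ GSp4 S := by
  obtain ⟨μ, hμ⟩ := hg
  refine ⟨Units.map f μ, ?_⟩
  have hJ : (formJ R).map f = formJ S := by
    ext i j; fin_cases i <;> fin_cases j <;> simp [formJ, block4]
  have h := congrArg (fun M => Matrix.map M f) hμ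
  simp only [Matrix.map_mul, hJ, Matrix.map_smul' f _ _ (map_mul f)] at h
  simpa [Matrix.transpose_map] using h

theorem map_s1 : Matrix.GeneralLinearGroup.map f (s1 R) = s1 S := by
  ext i j; fin_cases i <;> fin_cases j <;> simp [s1]

theorem map_s2 : Matrix.GeneralLinearGroup.map f (s2 R) = s2 S := by
  ext i j; fin_cases i <;> fin_cases j <;> simp [s2]

theorem map_weylOneElt (i : Fin 4) :
    Matrix.GeneralLinearGroup.map f (weylOneElt R i) = weylOneElt S i := by
  fin_cases i <;> simp [weylOneElt, map_s1, map_s2]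

theorem map_unipW (w : R) : Matrix.GeneralLinearGroup.map f (unipW w) = unipW (f w) := by
  ext i j; fin_cases i <;> fin_cases j <;> simp [unipW]

theorem map_lineElt (o : Option R) :
    Matrix.GeneralLinearGroup.map f (lineElt o) = lineElt (o.map f) := by
  cases o <;> simp [lineElt, map_s1, map_unipW]

theorem map_unipElt (p q r : R) :
    Matrix.GeneralLinearGroup.map f (unipElt p q r) = unipElt (f p) (f q) (f r) := by
  ext i j; fin_cases i <;> fin_cases j <;> simp [unipElt]

theorem map_torusElt (a b c x y : R) (u : Rˣ) (hu : (u : R) = x ^ 2 + b * x * y + a * c * y ^ 2)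
    (v : Sˣ) (hv : (v : S) = f x ^ 2 + f b * f x * f y + f a * f c * f y ^ 2) :
    Matrix.GeneralLinearGroup.map f (torusElt a b c x y u hu) =
      torusElt (f a) (f b) (f c) (f x) (f y) v hv := by
  ext i j; fin_cases i <;> fin_cases j <;> simp [torusElt]

end Map

/-! ### From the residue field to the local field -/

section Lift

/-- A disjoint union may be reindexed along a surjection. Nothing is required of its fibres:
different indices with the same image can only have empty sets. -/
theorem IsDisjointUnion.of_surjective {α ι ι' : Type*} {X : Set α} {f : ι → Set α} {g : ι' → Set α}
    (h : IsDisjointUnion X g) (e : ι' → ι) (he : Function.Surjective e) (hfg : ∀ i, f (e i) = g i) :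
    IsDisjointUnion X f := by
  refine ⟨?_, ?_⟩
  · rw [h.1, ← he.iUnion_comp]
    simp only [hfg]
  · intro i j hij
    obtain ⟨i, rfl⟩ := he i
    obtain ⟨j, rfl⟩ := he j
    have := h.2 (show i ≠ j from fun h => hij (by rw [h]))
    simpa only [Function.onFun, hfg] using this

variable {F : Type*} [Field F]

theorem hlm_val (ϖ : Fˣ) (l : ℤ) (m : ℕ) : (hlm ϖ l m).val = Matrix.diagonal
    ![((ϖ : F) ^ m) ^ 2 * (ϖ : F) ^ l, (ϖ : F) ^ m * (ϖ : F) ^ l, 1, (ϖ : F) ^ m] := by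
  have h := ϖ.ne_zero
  simp only [hlm]
  congr 1
  funext i
  fin_cases i <;> simp [zpow_add₀ h, zpow_mul, ← pow_mul, mul_comm]

/-- `h(l,m)` normalizes `U(F)`. -/
theorem conj_unipElt_mem (a b c : F) (ϖ : Fˣ) (l : ℤ) (m : ℕ) (p q r : F) :
    hlm ϖ l m * unipElt p q r * (hlm ϖ l m)⁻¹ ∈ besselSubgroup a b c := by
  have : hlm ϖ l m * unipElt p q r * (hlm ϖ l m)⁻¹ =
      unipElt (((ϖ : F) ^ m) ^ 2 * (ϖ : F) ^ l * p) ((ϖ : F) ^ m * (ϖ : F) ^ l * q)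
        ((ϖ : F) ^ l * r) := by
    rw [mul_inv_eq_iff_eq_mul]
    ext i j
    rw [Units.val_mul, Units.val_mul, hlm_val]
    fin_cases i <;> fin_cases j <;> simp [unipElt, Matrix.mul_apply, Matrix.diagonal_apply] <;> ring
  rw [this]
  exact unipElt_mem_besselSubgroup ..

/-- `h(l,m)` conjugates the torus of the coefficients `ϖ²ᵐ a, ϖᵐ b, c` into the one of `a, b, c`. -/
theorem conj_torusElt_mem (a b c : F) (ϖ : Fˣ) (l : ℤ) (m : ℕ) (x y : F) (u : Fˣ)
    (hu : (u : F) = x ^ 2 + ϖ ^ m * b * x * y + (ϖ ^ m) ^ 2 * a * c * y ^ 2) :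
    hlm ϖ l m * torusElt ((ϖ ^ m) ^ 2 * a) (ϖ ^ m * b) c x y u hu * (hlm ϖ l m)⁻¹ ∈
      besselSubgroup a b c := by
  have : hlm ϖ l m * torusElt ((ϖ ^ m) ^ 2 * a) (ϖ ^ m * b) c x y u hu * (hlm ϖ l m)⁻¹ =
      torusElt a b c x (ϖ ^ m * y) u (by rw [hu]; ring) := by
    rw [mul_inv_eq_iff_eq_mul]
    ext i j
    rw [Units.val_mul, Units.val_mul, hlm_val]
    fin_cases i <;> fin_cases j <;> simp [torusElt, Matrix.mul_apply, Matrix.diagonal_apply] <;> ring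
  rw [this]
  exact torusElt_mem_besselSubgroup ..

variable [ValuativeRel F]

noncomputable section

/-- Reduction modulo the maximal ideal. -/
abbrev reduction (F : Type*) [Field F] [ValuativeRel F] : GL (Fin 4) 𝒪[F] →* GL (Fin 4) 𝓀[F] :=
  Matrix.GeneralLinearGroup.map (IsLocalRing.residue 𝒪[F])

/-- The inclusion of `GL₄(𝔬)` into `GL₄(F)`. -/
abbrev inclusionGL (F : Type*) [Field F] [ValuativeRel F] : GL (Fin 4) 𝒪[F] →* GL (Fin 4) F :=
  Matrix.GeneralLinearGroup.map (algebraMap 𝒪[F] F)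

theorem mem_iwahori_iff {g : GL (Fin 4) F} :
    g ∈ iwahori F ↔ ∃ k ∈ GSp4 𝒪[F], reduction F k ∈ borel 𝓀[F] ∧ g = inclusionGL F k := by
  constructor
  · rintro ⟨k, hk, ⟨h01, h20, h21, h30, h31, h32⟩, rfl⟩
    refine ⟨k, hk, ⟨⟨map_mem_GSp4 _ hk, ?_⟩, ?_⟩, rfl⟩ <;> simp [*]
  · rintro ⟨k, hk, ⟨⟨-, h20, h21, h30, h31⟩, h01, h32⟩, rfl⟩
    refine ⟨k, hk, ?_, rfl⟩
    simp_all

/-- The elements of `GL₄(𝔬)` that `h(l,m)` conjugates into `R(F)` have a Bessel shape for the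
form with coefficients `ϖ²ᵐ a, ϖᵐ b, c`. -/
theorem exists_of_conj_mem {a b c : 𝒪[F]} (hc : IsUnit c) {ϖ : Fˣ} {π : 𝒪[F]} (hπ : (π : F) = ϖ)
    (l : ℤ) (m : ℕ) {q : GL (Fin 4) 𝒪[F]}
    (hq : hlm ϖ l m * inclusionGL F q * (hlm ϖ l m)⁻¹ ∈ besselSubgroup (a : F) b c) :
    (q.val 2 0 = 0 ∧ q.val 2 1 = 0 ∧ q.val 3 0 = 0 ∧ q.val 3 1 = 0) ∧
    ∃ x y : 𝒪[F], q.val 0 0 = x + y * (π ^ m * b) ∧ q.val 0 1 = y * c ∧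
      q.val 1 0 = -(y * ((π ^ m) ^ 2 * a)) ∧ q.val 1 1 = x := by
  obtain ⟨g, hg⟩ : ∃ g, g = hlm ϖ l m * inclusionGL F q * (hlm ϖ l m)⁻¹ := ⟨_, rfl⟩
  rw [← hg] at hq
  obtain ⟨⟨-, h20, h21, h30, h31⟩, x, y, ⟨h00, h01, h10, h11⟩, -⟩ := hq
  rw [eq_mul_inv_iff_mul_eq] at hg
  have hP : (ϖ : F) ^ m ≠ 0 := pow_ne_zero _ ϖ.ne_zero
  have hQ : (ϖ : F) ^ l ≠ 0 := zpow_ne_zero _ ϖ.ne_zero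
  have hent : ∀ i j, (g * hlm ϖ l m).val i j = (hlm ϖ l m * inclusionGL F q).val i j :=
    fun i j => by rw [hg]
  simp only [Units.val_mul, hlm_val, Matrix.mul_diagonal, Matrix.diagonal_mul] at hent
  have e20 := hent 2 0
  have e21 := hent 2 1
  have e30 := hent 3 0
  have e31 := hent 3 1
  have e00 := hent 0 0
  have e01 := hent 0 1
  have e10 := hent 1 0
  have e11 := hent 1 1
  have hcoe : ∀ z : 𝒪[F], algebraMap 𝒪[F] F z = (z : F) := fun _ => rfl
  simp [*] at e20 e21 e30 e31 e00 e01 e10 e11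
  refine ⟨⟨Subtype.ext e20.symm, Subtype.ext e21.symm, e30, e31⟩, ?_⟩
  obtain ⟨c, rfl⟩ := hc
  set C : 𝒪[F] := (c : 𝒪[F]) with hC
  obtain ⟨y', hy'⟩ : ∃ y' : 𝒪[F], q.val 0 1 = y' * C :=
    ⟨q.val 0 1 * ((c⁻¹ : 𝒪[F]ˣ) : 𝒪[F]), by rw [hC, mul_assoc, Units.inv_mul, mul_one]⟩
  have hc0 : (C : F) ≠ 0 := fun h => c.ne_zero (Subtype.ext h)
  have hPQ : (ϖ : F) ^ m * (ϖ : F) ^ l ≠ 0 := mul_ne_zero hP hQ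
  have hy : y = (ϖ : F) ^ m * y' := by
    rw [hy'] at e01
    push_cast at e01
    apply mul_right_cancel₀ hc0
    apply mul_right_cancel₀ hPQ
    linear_combination e01
  have h11' : x = (q.val 1 1 : F) := by
    apply mul_right_cancel₀ hPQ
    linear_combination e11
  refine ⟨q.val 1 1, y', ?_, hy', ?_, rfl⟩
  · apply Subtype.ext
    push_cast
    rw [hπ]
    apply mul_left_cancel₀ (mul_ne_zero hP hPQ)
    rw [hy, h11'] at e00
    linear_combination -e00
  · apply Subtype.ext
    push_cast
    rw [hπ]
    apply mul_left_cancel₀ hPQ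
    rw [hy] at e10
    linear_combination -e10

/-- The decomposition of `R(F) h(l,m) K` in terms of the zeros in the residue field of the
polynomial `c w² + ϖᵐ b w + ϖ²ᵐ a`. -/
theorem isDisjointUnion_cosetRI [NeZero (2 : F)] {a b c : 𝒪[F]} (hc : IsUnit c) {ϖ : Fˣ}
    {π : 𝒪[F]} (hπ : (π : F) = ϖ) (l : ℤ) (m : ℕ) {ι : Type*} (w : ι → 𝒪[F])
    (hinj : Function.Injective fun i => IsLocalRing.residue 𝒪[F] (w i))
    (hroot : ∀ z : 𝒪[F], c * z ^ 2 + π ^ m * b * z + (π ^ m) ^ 2 * a ∈ 𝓂[F] ↔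
      ∃ i, IsLocalRing.residue 𝒪[F] (w i) = IsLocalRing.residue 𝒪[F] z) :
    IsDisjointUnion (cosetRK (a : F) b c (hlm ϖ l m))
      (fun p : Option ι × Fin 4 => cosetRI (a : F) b c
        (hlm ϖ l m * (lineElt (p.1.map fun i => (w i : F)) * weylOneElt F p.2))) := by
  have hcF : (c : F) ≠ 0 := fun h => hc.ne_zero (Subtype.ext h)
  have hR := coe_besselSubgroup (a := (a : F)) (b := b) hcF
  set res := IsLocalRing.residue 𝒪[F] with hres
  have hres0 : ∀ z, res z = 0 ↔ z ∈ 𝓂[F] := fun z => IsLocalRing.residue_eq_zero_iff z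
  have hsurj : Function.Surjective res := IsLocalRing.residue_surjective
  have hck : res c ≠ 0 := (hc.map res).ne_zero
  -- the representatives, over `𝔬`
  set X : Option ι × Fin 4 → GL (Fin 4) 𝒪[F] := fun p => lineElt (p.1.map w) * weylOneElt _ p.2
    with hX
  have hXG : ∀ p, X p ∈ GSp4 𝒪[F] := fun p =>
    mul_mem (lineElt_mem_siegelLevi _).1.1 (weylOneElt_mem_GSp4 _)
  have hXF : ∀ p : Option ι × Fin 4, lineElt (p.1.map fun i => (w i : F)) * weylOneElt F p.2 =
      inclusionGL F (X p) := by
    intro p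
    rw [hX, map_mul, map_lineElt, map_weylOneElt, Option.map_map]
    rfl
  have hXk : ∀ p, reduction F (X p) =
      lineElt (p.1.map fun i => res (w i)) * weylOneElt 𝓀[F] p.2 := by
    intro p
    rw [hX, map_mul, map_lineElt, map_weylOneElt, Option.map_map]
    rfl
  have hrootk : ∀ (o : Option ι) (z : 𝓀[F]), (o.map fun i => res (w i)) = some z →
      res c * z ^ 2 + res (π ^ m * b) * z + res ((π ^ m) ^ 2 * a) = 0 := by
    rintro (_ | i) z h
    · cases h
    · cases h
      have := (hres0 _).2 ((hroot (w i)).2 ⟨i, rfl⟩)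
      simpa only [map_add, map_mul, map_pow] using this
  simp only [hXF]
  refine ⟨Set.Subset.antisymm ?_ ?_, ?_⟩
  · intro g hg
    rw [cosetRK, DoubleCoset.mem_doubleCoset, ← hR] at hg
    obtain ⟨r, hr, -, ⟨k, hk, rfl⟩, rfl⟩ := hg
    obtain ⟨p, q, s, x, y, u, hu, o, ho, i, β, hβ, heq⟩ :=
      exists_eq_bessel_mul_borel (res ((π ^ m) ^ 2 * a)) (res (π ^ m * b)) hck
        (map_mem_GSp4 res hk)
    obtain ⟨p, rfl⟩ := hsurj p
    obtain ⟨q, rfl⟩ := hsurj q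
    obtain ⟨s, rfl⟩ := hsurj s
    obtain ⟨x, rfl⟩ := hsurj x
    obtain ⟨y, rfl⟩ := hsurj y
    obtain ⟨o, rfl⟩ : ∃ o' : Option ι, o = o'.map fun i => res (w i) := by
      cases o with
      | none => exact ⟨none, rfl⟩
      | some z =>
        obtain ⟨z, rfl⟩ := hsurj z
        have hz := ho _ rfl
        simp only [← map_mul, ← map_pow, ← map_add] at hz
        obtain ⟨i, hi⟩ := (hroot z).1 ((hres0 _).1 hz)
        exact ⟨some i, by simp [hi]⟩
    obtain ⟨v, hv⟩ : IsUnit (x ^ 2 + π ^ m * b * x * y + (π ^ m) ^ 2 * a * c * y ^ 2) := by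
      rw [← IsLocalRing.residue_ne_zero_iff_isUnit]
      have h0 := u.ne_zero
      rw [hu] at h0
      simpa only [map_add, map_mul, map_pow] using h0
    set T := torusElt ((π ^ m) ^ 2 * a) (π ^ m * b) c x y v hv with hT
    have hTred : reduction F T = _ := map_torusElt res _ _ _ _ _ _ hv _ hu
    have hTinc : inclusionGL F T = torusElt (((ϖ : F) ^ m) ^ 2 * a) ((ϖ : F) ^ m * b) c x y
        (Units.map (algebraMap 𝒪[F] F).toMonoidHom v) (by
          have := congrArg (algebraMap 𝒪[F] F) hv
          simp only [map_add, map_mul, map_pow] at this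
          rw [← hπ]
          exact this) := by
      have h1 : (algebraMap 𝒪[F] F) ((π ^ m) ^ 2 * a) = ((ϖ : F) ^ m) ^ 2 * a := by
        rw [← hπ]; rfl
      have h2 : (algebraMap 𝒪[F] F) (π ^ m * b) = (ϖ : F) ^ m * b := by
        rw [← hπ]; rfl
      simp only [← h1, ← h2]
      exact map_torusElt (algebraMap 𝒪[F] F) _ _ _ _ _ _ hv _ _
    have hβ' : reduction F ((X (o, i))⁻¹ * T⁻¹ * (unipElt p q s)⁻¹ * k) = β := by
      rw [map_mul, map_mul, map_mul, map_inv, map_inv, map_inv, hXk, hTred,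
        show reduction F (unipElt p q s) = _ from map_unipElt res p q s,
        show reduction F k = _ from heq]
      group
    rw [Set.mem_iUnion]
    refine ⟨(o, i), ?_⟩
    rw [cosetRI, DoubleCoset.mem_doubleCoset, ← hR]
    refine ⟨r * (hlm ϖ l m * inclusionGL F (unipElt p q s) * (hlm ϖ l m)⁻¹) *
      (hlm ϖ l m * inclusionGL F T * (hlm ϖ l m)⁻¹), mul_mem (mul_mem hr ?_) ?_,
      inclusionGL F ((X (o, i))⁻¹ * T⁻¹ * (unipElt p q s)⁻¹ * k),
      mem_iwahori_iff.2 ⟨_, mul_mem (mul_mem (mul_mem (inv_mem (hXG _))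
        (inv_mem (torusElt_mem_siegelLevi ..).1.1))
        (inv_mem (unipElt_mem_siegelParabolic ..).1)) hk, by rwa [hβ'], rfl⟩, ?_⟩
    · rw [map_unipElt]
      exact conj_unipElt_mem ..
    · rw [hTinc]
      exact conj_torusElt_mem ..
    · simp only [map_mul, map_inv]
      change _ * inclusionGL F k = _
      group
  · intro g hg
    obtain ⟨p, hp⟩ := Set.mem_iUnion.1 hg
    rw [cosetRI, DoubleCoset.mem_doubleCoset] at hp
    obtain ⟨r, hr, y, hy, rfl⟩ := hp
    obtain ⟨k, hk, -, rfl⟩ := mem_iwahori_iff.1 hy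
    rw [cosetRK, DoubleCoset.mem_doubleCoset]
    exact ⟨r, hr, inclusionGL F (X p * k), ⟨_, mul_mem (hXG p) hk, rfl⟩, by
      simp only [map_mul, mul_assoc]⟩
  · intro p p' hpp
    rw [Function.onFun, Set.disjoint_left]
    intro g hg hg'
    apply hpp
    rw [cosetRI, DoubleCoset.mem_doubleCoset, ← hR] at hg hg'
    obtain ⟨r, hr, y, hy, rfl⟩ := hg
    obtain ⟨r', hr', y', hy', heq⟩ := hg'
    obtain ⟨k, hk, hkB, rfl⟩ := mem_iwahori_iff.1 hy
    obtain ⟨k', hk', hkB', rfl⟩ := mem_iwahori_iff.1 hy'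
    -- `r⁻¹ r'` is the conjugate of an element of `GSp₄(𝔬)`
    have hq : hlm ϖ l m * inclusionGL F (X p * k * k'⁻¹ * (X p')⁻¹) * (hlm ϖ l m)⁻¹ ∈
        besselSubgroup (a : F) b c := by
      have : hlm ϖ l m * inclusionGL F (X p * k * k'⁻¹ * (X p')⁻¹) * (hlm ϖ l m)⁻¹ =
          r⁻¹ * r' := by
        simp only [map_mul, map_inv]
        rw [eq_inv_mul_iff_mul_eq]
        have h1 := congrArg
          (fun z => z * (inclusionGL F k')⁻¹ * (inclusionGL F (X p'))⁻¹ * (hlm ϖ l m)⁻¹) heq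
        simpa [mul_assoc] using h1
      rw [this]
      exact mul_mem (inv_mem hr) hr'
    obtain ⟨hC, x, y, h00, h01, h10, h11⟩ := exists_of_conj_mem hc hπ l m hq
    set q := X p * k * k'⁻¹ * (X p')⁻¹ with hqdef
    have hqG : q ∈ siegelParabolic 𝒪[F] :=
      ⟨mul_mem (mul_mem (mul_mem (hXG p) hk) (inv_mem hk')) (inv_mem (hXG p')), hC⟩
    have hqk : reduction F q ∈ siegelParabolic 𝓀[F] :=
      ⟨map_mem_GSp4 _ hqG.1, by simp [hC]⟩
    obtain ⟨h1, h2⟩ := eq_of_mem_borel hqk (a := res ((π ^ m) ^ 2 * a)) (b := res (π ^ m * b))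
      (c := res c) (x := res x) (y := res y) (i := p.2) (j := p'.2)
      (o := p.1.map fun i => res (w i)) (o' := p'.1.map fun i => res (w i))
      (by simp [h00, hres]) (by simp [h01, hres]) (by simp [h10, hres]) (by simp [h11, hres])
      (hrootk _) (hrootk _) (by
        rw [← hXk, ← hXk, hqdef]
        have : (reduction F (X p))⁻¹ * reduction F (X p * k * k'⁻¹ * (X p')⁻¹) *
            reduction F (X p') = reduction F k * (reduction F k')⁻¹ := by
          simp only [map_mul, map_inv]
          group
        rw [this]
        exact mul_mem hkB (inv_mem hkB'))
    exact Prod.ext (Option.map_injective hinj h1) h2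

end

end Lift

/-! ### Zeros of the quadratic polynomial modulo the maximal ideal -/

section Arithmetic

variable {F : Type*} [Field F] [ValuativeRel F]

open Polynomial in
/-- Hensel's lemma for a quadratic polynomial: a zero modulo the maximal ideal makes a unit
discriminant a square. -/
theorem isSquare_disc_of_root [TopologicalSpace F] [IsNonarchimedeanLocalField F] {a b c z : 𝒪[F]}
    (hd : disc a b c ∉ 𝓂[F]) (hz : c * z ^ 2 + b * z + a ∈ 𝓂[F]) :
    IsSquare (disc a b c) := by
  let := IsTopologicalAddGroup.rightUniformSpace F
  have := isUniformAddGroup_of_addCommGroup (G := F)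
  have hmon : (X ^ 2 + C b * X + C (a * c) : 𝒪[F][X]).Monic := by monicity!
  -- the derivative at the approximate zero `c z` squares to the discriminant modulo `𝔭`
  have hu : IsUnit (2 * (c * z) + b) := by
    rw [← IsLocalRing.notMem_maximalIdeal]
    intro h
    apply hd
    have h1 := Ideal.sub_mem _ (Ideal.mul_mem_left _ (2 * (c * z) + b) h)
      (Ideal.mul_mem_left _ (4 * c) hz)
    convert h1 using 1
    rw [disc]; ring
  obtain ⟨x, hx, -⟩ := HenselianRing.is_henselian (I := 𝓂[F]) _ hmon (c * z)
    (by
      have := Ideal.mul_mem_left _ c hz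
      simp only [eval_add, eval_pow, eval_X, eval_mul, eval_C]
      convert this using 1
      ring)
    (by
      have : (derivative (X ^ 2 + C b * X + C (a * c) : 𝒪[F][X])).eval (c * z) =
        2 * (c * z) + b := by simp [one_add_one_eq_two]
      rw [this]
      exact hu.map _)
  refine ⟨2 * x + b, ?_⟩
  simp only [IsRoot.def, eval_add, eval_pow, eval_X, eval_mul, eval_C] at hx
  rw [disc]
  linear_combination -4 * hx

/-- Over a finite field, a quadratic polynomial with vanishing discriminant has a unique zero. -/
theorem existsUnique_root_of_disc_eq_zero {k : Type*} [Field k] [Finite k] {a b c : k} (hc : c ≠ 0)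
    (hd : disc a b c = 0) : ∃! z : k, c * z ^ 2 + b * z + a = 0 := by
  rw [disc] at hd
  apply existsUnique_of_exists_of_unique
  · by_cases h2 : (2 : k) = 0
    · have := Fintype.ofFinite k
      have : CharP k 2 := CharTwo.of_one_ne_zero_of_two_eq_zero one_ne_zero h2
      obtain ⟨z, hz⟩ := FiniteField.isSquare_of_char_two (ringChar.eq k 2) (-a / c)
      have hb : b = 0 := by
        apply pow_eq_zero_iff two_ne_zero |>.1
        linear_combination hd + 2 * a * c * h2
      refine ⟨z, ?_⟩
      rw [hb, pow_two, ← hz]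
      field_simp
      ring
    · refine ⟨-b / (2 * c), ?_⟩
      field_simp
      linear_combination -hd
  · intro z z' hz hz'
    have h1 : 2 * c * z + b = 0 := by
      apply pow_eq_zero_iff two_ne_zero |>.1
      linear_combination hd + 4 * c * hz
    have h2 : c * (z - z') ^ 2 = 0 := by
      linear_combination (z - z') * h1 - hz + hz'
    simpa [hc, sub_eq_zero] using h2

end Arithmetic

/-! ### Integrality and the maximal ideal of `𝔬_L` -/

section Quadratic

variable {F : Type*} [Field F] [ValuativeRel F] [CharZero F]

/-- In the ramified case, membership of `α + w` in the maximal ideal of `𝔬_L` can be read off from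
its norm, because its trace is divisible by `𝔭` whenever its norm is. -/
theorem exists_mem_maximal_iff {a b c : 𝒪[F]} (hc : IsUnit c) (hd : disc a b c ∈ 𝓂[F])
    (pL : Ideal (integersL (disc (a : F) b c))) (hpL : pL.IsMaximal) (w : 𝒪[F]) :
    (∃ y ∈ pL, (y : QuadExt (disc (a : F) b c)) =
      alpha (a : F) b c + algebraMap F (QuadExt (disc (a : F) b c)) w) ↔
      c * w ^ 2 + b * w + a ∈ 𝓂[F] := by
  obtain ⟨e, he⟩ := hc.exists_right_inv
  have heF : (c : F) * (e : F) = 1 := congrArg Subtype.val he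
  have hcF : (c : F) ≠ 0 := left_ne_zero_of_mul_eq_one heF
  set β : QuadExt (disc (a : F) b c) :=
    alpha (a : F) b c + algebraMap F (QuadExt (disc (a : F) b c)) w with hβ
  -- norm and trace
  set n : 𝒪[F] := (c * w ^ 2 + b * w + a) * e with hn
  set t : 𝒪[F] := b * e + 2 * w with ht
  have heq : β * (algebraMap 𝒪[F] (QuadExt (disc (a : F) b c)) t - β) =
      algebraMap 𝒪[F] (QuadExt (disc (a : F) b c)) n := by
    have e' : (e : F) = (c : F)⁻¹ := eq_inv_of_mul_eq_one_right heF
    have hβ' : β = ⟨b / (2 * c) + w, 1 / (2 * c)⟩ := by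
      rw [hβ, alpha]
      ext
      · simp
        ring
      · simp
    change β * (⟨((t : 𝒪[F]) : F), 0⟩ - β) = ⟨((n : 𝒪[F]) : F), 0⟩
    have h2 : ((2 : 𝒪[F]) : F) = 2 := rfl
    have hdisc : disc (a : F) b c = b ^ 2 - 4 * a * c := rfl
    rw [hβ']
    ext
    · simp only [QuadraticAlgebra.re_mul, QuadraticAlgebra.re_sub, QuadraticAlgebra.im_sub]
      rw [hdisc, hn, ht]
      push_cast
      rw [e', h2]
      field_simp
      ring
    · simp only [QuadraticAlgebra.im_mul, QuadraticAlgebra.re_sub, QuadraticAlgebra.im_sub]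
      rw [ht]
      push_cast
      rw [e', h2]
      field_simp
      ring
  have hint : IsIntegral 𝒪[F] β := by
    refine ⟨Polynomial.X ^ 2 - Polynomial.C t * Polynomial.X + Polynomial.C n,
      by monicity!, ?_⟩
    simp only [Polynomial.eval₂_add, Polynomial.eval₂_sub, Polynomial.eval₂_mul,
      Polynomial.eval₂_pow, Polynomial.eval₂_X, Polynomial.eval₂_C]
    rw [← heq]
    ring
  set y : integersL (disc (a : F) b c) := ⟨β, hint⟩ with hy
  have heqy : y * (algebraMap 𝒪[F] _ t - y) = algebraMap 𝒪[F] _ n := Subtype.ext heq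
  have hcomap : ∀ z : 𝒪[F], algebraMap 𝒪[F] (integersL (disc (a : F) b c)) z ∈ pL ↔ z ∈ 𝓂[F] := by
    intro z
    have : (pL.comap (algebraMap 𝒪[F] (integersL (disc (a : F) b c)))).IsMaximal :=
      Ideal.isMaximal_comap_of_isIntegral_of_isMaximal pL
    rw [← IsLocalRing.eq_maximalIdeal this, Ideal.mem_comap]
  have hnm : n ∈ 𝓂[F] ↔ c * w ^ 2 + b * w + a ∈ 𝓂[F] := by
    refine ⟨fun h => ?_, fun h => Ideal.mul_mem_right _ _ h⟩
    have := Ideal.mul_mem_right c _ h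
    rwa [hn, mul_assoc, mul_comm e, he, mul_one] at this
  rw [← hnm, ← hcomap]
  constructor
  · rintro ⟨y', hy', hyβ⟩
    rw [← heqy]
    have : y' = y := Subtype.ext hyβ
    exact Ideal.mul_mem_right _ _ (this ▸ hy')
  · intro h
    refine ⟨y, ?_, rfl⟩
    -- the discriminant `t² - 4 n` is `d / c²`
    have htm : t ∈ 𝓂[F] := by
      have h1 : t ^ 2 = disc a b c * e ^ 2 + 4 * n := by
        rw [ht, hn, disc]
        linear_combination (4 * a * e - 4 * w ^ 2) * he
      have h2 : t ^ 2 ∈ 𝓂[F] := by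
        rw [h1]
        exact Ideal.add_mem _ (Ideal.mul_mem_right _ _ hd) (Ideal.mul_mem_left _ _ ((hcomap n).1 h))
      exact Ideal.IsPrime.mem_of_pow_mem inferInstance _ h2
    rw [← heqy] at h
    rcases hpL.isPrime.mem_or_mem h with h | h
    · exact h
    · have := Ideal.sub_mem _ ((hcomap t).2 htm) h
      simpa using this

end Quadratic

section Split

variable {F : Type*} [Field F] [ValuativeRel F] [CharZero F]

/-- The zeros in `F` of a quadratic polynomial whose leading coefficient is a unit are integral. -/
theorem root_mem_integer {a b c : 𝒪[F]} (hc : IsUnit c) {δ : F}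
    (hδ : δ ^ 2 = disc (a : F) b c) : (-b + δ) / (2 * c) ∈ 𝒪[F] := by
  obtain ⟨e, he⟩ := hc.exists_right_inv
  have heF : (c : F) * (e : F) = 1 := congrArg Subtype.val he
  have hcF : (c : F) ≠ 0 := left_ne_zero_of_mul_eq_one heF
  have e' : (e : F) = (c : F)⁻¹ := eq_inv_of_mul_eq_one_right heF
  apply (Valuation.integer.integers (ValuativeRel.valuation F)).mem_of_integral
  refine ⟨Polynomial.X ^ 2 + Polynomial.C (b * e) * Polynomial.X + Polynomial.C (a * e),
    by monicity!, ?_⟩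
  simp only [Polynomial.eval₂_add, Polynomial.eval₂_mul, Polynomial.eval₂_pow,
    Polynomial.eval₂_X, Polynomial.eval₂_C]
  change ((-b + δ) / (2 * c)) ^ 2 + (b * e : F) * ((-b + δ) / (2 * c)) + (a * e : F) = 0
  rw [disc] at hδ
  rw [e']
  field_simp
  linear_combination hδ

end Split

/-! ### The decompositions -/

section Decomposition

theorem weylOneElt_mem_weylOne {F : Type*} [Field F] (i : Fin 4) : weylOneElt F i ∈ weylOne F := by
  fin_cases i <;> simp [weylOneElt, weylOne]

theorem exists_weylOneElt_eq {F : Type*} [Field F] {s : GL (Fin 4) F} (hs : s ∈ weylOne F) :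
    ∃ i, weylOneElt F i = s := by
  rcases hs with rfl | rfl | rfl | rfl
  exacts [⟨0, rfl⟩, ⟨1, rfl⟩, ⟨2, rfl⟩, ⟨3, rfl⟩]

theorem weylOneElt_mem_weyl {F : Type*} [Field F] (i : Fin 4) : weylOneElt F i ∈ weyl F := by
  fin_cases i <;> simp [weylOneElt, weyl]

theorem s1_mul_weylOneElt_mem_weyl {F : Type*} [Field F] (i : Fin 4) :
    s1 F * weylOneElt F i ∈ weyl F := by
  fin_cases i <;> simp [weylOneElt, weyl, mul_assoc]

/-- `W` is the union of `W⁽¹⁾` and `s₁ W⁽¹⁾`. -/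
theorem exists_weylOneElt_eq_or {F : Type*} [Field F] {s : GL (Fin 4) F} (hs : s ∈ weyl F) :
    ∃ i, weylOneElt F i = s ∨ s1 F * weylOneElt F i = s := by
  rcases hs with rfl | rfl | rfl | rfl | rfl | rfl | rfl | rfl
  exacts [⟨0, .inl rfl⟩, ⟨0, .inr (mul_one _)⟩, ⟨1, .inl rfl⟩, ⟨1, .inr rfl⟩, ⟨2, .inl rfl⟩,
    ⟨2, .inr (mul_assoc _ _ _).symm⟩, ⟨3, .inl rfl⟩,
    ⟨3, .inr (by simp [weylOneElt, mul_assoc])⟩]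

theorem unipW_zero {R : Type*} [CommRing R] : unipW (0 : R) = 1 := by
  ext i j; fin_cases i <;> fin_cases j <;> simp [unipW]

variable {F : Type*} [Field F] [ValuativeRel F] [CharZero F]

/-- For `m > 0` the form degenerates modulo `𝔭` to `c w²`, whose only zero is `0`. -/
theorem isDisjointUnion_of_pos {a b c : 𝒪[F]} (hc : IsUnit c) {ϖ : Fˣ}
    {π : 𝒪[F]} (hπ : (π : F) = ϖ) (hπm : π ∈ 𝓂[F]) (l : ℤ) {m : ℕ} (hm : 0 < m) :
    IsDisjointUnion (cosetRK (a : F) b c (hlm ϖ l m))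
      (fun s : weyl F => cosetRI (a : F) b c (hlm ϖ l m * s)) := by
  have hπm' : π ^ m ∈ 𝓂[F] := Ideal.pow_mem_of_mem _ hπm m hm
  refine (isDisjointUnion_cosetRI (a := a) (b := b) hc hπ l m (fun _ : Unit => (0 : 𝒪[F]))
    (fun _ _ _ => rfl) ?_).of_surjective
    (fun p => match p with
      | (none, i) => ⟨weylOneElt F i, weylOneElt_mem_weyl i⟩
      | (some _, i) => ⟨s1 F * weylOneElt F i, s1_mul_weylOneElt_mem_weyl i⟩) ?_ ?_
  · intro z
    rw [pow_two (π ^ m), mul_assoc (π ^ m) b z, mul_assoc (π ^ m) (π ^ m) a, add_assoc,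
      Ideal.add_mem_iff_left _ (Ideal.add_mem _ (Ideal.mul_mem_right _ _ hπm')
        (Ideal.mul_mem_right _ _ hπm')), Ideal.unit_mul_mem_iff_mem _ hc, map_zero,
      eq_comm (a := (0 : 𝓀[F])), IsLocalRing.residue_eq_zero_iff]
    simp [Ideal.IsPrime.pow_mem_iff_mem (I := 𝓂[F]) inferInstance 2 two_pos]
  · rintro ⟨s, hs⟩
    obtain ⟨i, rfl | rfl⟩ := exists_weylOneElt_eq_or hs
    exacts [⟨(none, i), rfl⟩, ⟨(some (), i), rfl⟩]
  · rintro ⟨_ | _, i⟩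
    · simp [lineElt]
    · simp [lineElt, unipW_zero]

theorem isDisjointUnion_zero {a b c : 𝒪[F]} (hc : IsUnit c) {ϖ : Fˣ}
    {π : 𝒪[F]} (hπ : (π : F) = ϖ) (l : ℤ) {ι : Type*} (w : ι → 𝒪[F])
    (hinj : Function.Injective fun i => IsLocalRing.residue 𝒪[F] (w i))
    (hroot : ∀ z : 𝒪[F], c * z ^ 2 + b * z + a ∈ 𝓂[F] ↔
      ∃ i, IsLocalRing.residue 𝒪[F] (w i) = IsLocalRing.residue 𝒪[F] z) :
    IsDisjointUnion (cosetRK (a : F) b c (hlm ϖ l 0))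
      (fun p : Option ι × Fin 4 => cosetRI (a : F) b c
        (hlm ϖ l 0 * (lineElt (p.1.map fun i => (w i : F)) * weylOneElt F p.2))) :=
  isDisjointUnion_cosetRI hc hπ l 0 w hinj (by simpa using hroot)

theorem isDisjointUnion_of_no_root {a b c : 𝒪[F]} (hc : IsUnit c) {ϖ : Fˣ}
    {π : 𝒪[F]} (hπ : (π : F) = ϖ) (l : ℤ) (hroot : ∀ z : 𝒪[F], c * z ^ 2 + b * z + a ∉ 𝓂[F]) :
    IsDisjointUnion (cosetRK (a : F) b c (hlm ϖ l 0))
      (fun s : weylOne F => cosetRI (a : F) b c (hlm ϖ l 0 * s)) := by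
  refine (isDisjointUnion_zero (a := a) (b := b) hc hπ l (fun i : Empty => i.elim)
    (fun i => i.elim) (by simpa using hroot)).of_surjective
    (fun p => ⟨weylOneElt F p.2, weylOneElt_mem_weylOne p.2⟩) ?_ ?_
  · rintro ⟨s, hs⟩
    obtain ⟨i, rfl⟩ := exists_weylOneElt_eq hs
    exact ⟨(none, i), rfl⟩
  · rintro ⟨_ | i, _⟩
    · simp [lineElt]
    · exact i.elim

theorem isDisjointUnion_of_one_root {a b c : 𝒪[F]} (hc : IsUnit c) {ϖ : Fˣ}
    {π : 𝒪[F]} (hπ : (π : F) = ϖ) (l : ℤ) (w : 𝒪[F])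
    (hroot : ∀ z : 𝒪[F], c * z ^ 2 + b * z + a ∈ 𝓂[F] ↔
      IsLocalRing.residue 𝒪[F] w = IsLocalRing.residue 𝒪[F] z) :
    IsDisjointUnion (cosetRK (a : F) b c (hlm ϖ l 0))
      (Sum.elim
        (fun s : weylOne F => cosetRI (a : F) b c (hlm ϖ l 0 * s))
        (fun s : weylOne F => cosetRI (a : F) b c (hlm ϖ l 0 * unipW (w : F) * s1 F * s))) := by
  refine (isDisjointUnion_zero (a := a) (b := b) hc hπ l (fun _ : Unit => w)
    (fun _ _ _ => rfl) (by simpa using hroot)).of_surjective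
    (fun p => match p with
      | (none, i) => .inl ⟨weylOneElt F i, weylOneElt_mem_weylOne i⟩
      | (some _, i) => .inr ⟨weylOneElt F i, weylOneElt_mem_weylOne i⟩) ?_ ?_
  · rintro (⟨s, hs⟩ | ⟨s, hs⟩) <;> obtain ⟨i, rfl⟩ := exists_weylOneElt_eq hs
    exacts [⟨(none, i), rfl⟩, ⟨(some (), i), rfl⟩]
  · rintro ⟨_ | _, i⟩ <;> simp [lineElt, mul_assoc]

theorem isDisjointUnion_of_two_roots {a b c : 𝒪[F]} (hc : IsUnit c) {ϖ : Fˣ}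
    {π : 𝒪[F]} (hπ : (π : F) = ϖ) (l : ℤ) (w w' : 𝒪[F])
    (hne : IsLocalRing.residue 𝒪[F] w ≠ IsLocalRing.residue 𝒪[F] w')
    (hroot : ∀ z : 𝒪[F], c * z ^ 2 + b * z + a = c * ((z - w) * (z - w'))) :
    IsDisjointUnion (cosetRK (a : F) b c (hlm ϖ l 0))
      (Sum.elim
        (fun s : weylOne F => cosetRI (a : F) b c (hlm ϖ l 0 * s))
        (Sum.elim
          (fun s : weylOne F => cosetRI (a : F) b c (hlm ϖ l 0 * unipW (w : F) * s1 F * s))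
          (fun s : weylOne F =>
            cosetRI (a : F) b c (hlm ϖ l 0 * unipW (w' : F) * s1 F * s)))) := by
  refine (isDisjointUnion_zero (a := a) (b := b) hc hπ l (fun i : Bool => if i then w else w')
    ?_ ?_).of_surjective
    (fun p => match p with
      | (none, i) => .inl ⟨weylOneElt F i, weylOneElt_mem_weylOne i⟩
      | (some true, i) => .inr (.inl ⟨weylOneElt F i, weylOneElt_mem_weylOne i⟩)
      | (some false, i) => .inr (.inr ⟨weylOneElt F i, weylOneElt_mem_weylOne i⟩)) ?_ ?_
  · rintro (_ | _) (_ | _) h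
    exacts [rfl, absurd h.symm hne, absurd h hne, rfl]
  · intro z
    rw [hroot, Ideal.unit_mul_mem_iff_mem _ hc,
      Ideal.IsPrime.mul_mem_iff_mem_or_mem (I := 𝓂[F]) inferInstance,
      ← IsLocalRing.residue_eq_zero_iff, ← IsLocalRing.residue_eq_zero_iff, map_sub, map_sub,
      sub_eq_zero, sub_eq_zero]
    simp [eq_comm, or_comm]
  · rintro (⟨s, hs⟩ | ⟨s, hs⟩ | ⟨s, hs⟩) <;> obtain ⟨i, rfl⟩ := exists_weylOneElt_eq hs
    exacts [⟨(none, i), rfl⟩, ⟨(some true, i), rfl⟩, ⟨(some false, i), rfl⟩]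
  · rintro ⟨_ | _ | _, i⟩ <;> simp [lineElt, mul_assoc]

end Decomposition

end BesselCosets

open BesselCosets in
theorem proposition3p1 {F : Type*} [Field F] [ValuativeRel F] [TopologicalSpace F]
    [IsNonarchimedeanLocalField F] [CharZero F]
    (ϖ : Fˣ) (hϖ : ∃ π : 𝒪[F], Irreducible π ∧ (π : F) = ϖ)
    (a b c : 𝒪[F]) (hc : IsUnit c) (hd : disc a b c ≠ 0)
    (hA2 : ¬ IsSquare (disc (a : F) b c) →
      Ideal.span {disc a b c} = discIdeal (disc (a : F) b c))
    (hA2' : IsSquare (disc (a : F) b c) → IsUnit (disc a b c))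
    (l : ℤ) :
    -- the case `m > 0`
    (∀ m : ℕ, 0 < m →
      IsDisjointUnion (cosetRK (a : F) b c (hlm ϖ l m))
        (fun s : weyl F => cosetRI (a : F) b c (hlm ϖ l m * s))) ∧
    -- the case `m = 0`, inert
    (legendreL (disc a b c) = -1 →
      IsDisjointUnion (cosetRK (a : F) b c (hlm ϖ l 0))
        (fun s : weylOne F => cosetRI (a : F) b c (hlm ϖ l 0 * s))) ∧
    -- the case `m = 0`, ramified; `pL` is the maximal ideal of the ring of integers of `L`
    (legendreL (disc a b c) = 0 →
      ∀ pL : Ideal (integersL (disc (a : F) b c)), pL.IsMaximal →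
        (∃! wbar : 𝓀[F], ∀ w : 𝒪[F], IsLocalRing.residue 𝒪[F] w = wbar →
          ∃ y ∈ pL, (y : QuadExt (disc (a : F) b c)) =
            alpha (a : F) b c + algebraMap F (QuadExt (disc (a : F) b c)) w) ∧
        (Odd (Nat.card 𝓀[F]) → ∃ w : 𝒪[F], (w : F) = -b / (2 * c) ∧
          ∃ y ∈ pL, (y : QuadExt (disc (a : F) b c)) =
            alpha (a : F) b c + algebraMap F (QuadExt (disc (a : F) b c)) w) ∧
        ∀ w₀ : 𝒪[F],
          (∃ y ∈ pL, (y : QuadExt (disc (a : F) b c)) =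
            alpha (a : F) b c + algebraMap F (QuadExt (disc (a : F) b c)) w₀) →
          IsDisjointUnion (cosetRK (a : F) b c (hlm ϖ l 0))
            (Sum.elim
              (fun s : weylOne F => cosetRI (a : F) b c (hlm ϖ l 0 * s))
              (fun s : weylOne F =>
                cosetRI (a : F) b c (hlm ϖ l 0 * unipW (w₀ : F) * s1 F * s)))) ∧
    -- the case `m = 0`, split
    (legendreL (disc a b c) = 1 →
      ∀ δ : F, δ ^ 2 = disc (a : F) b c →
        (-b + δ) / (2 * c) ∈ 𝒪[F] ∧ (-b - δ) / (2 * c) ∈ 𝒪[F] ∧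
        IsDisjointUnion (cosetRK (a : F) b c (hlm ϖ l 0))
          (Sum.elim
            (fun s : weylOne F => cosetRI (a : F) b c (hlm ϖ l 0 * s))
            (Sum.elim
              (fun s : weylOne F =>
                cosetRI (a : F) b c (hlm ϖ l 0 * unipW ((-b + δ) / (2 * c)) * s1 F * s))
              (fun s : weylOne F =>
                cosetRI (a : F) b c (hlm ϖ l 0 * unipW ((-b - δ) / (2 * c)) * s1 F * s))))) := by
  obtain ⟨π, hπirr, hπ⟩ := hϖ
  have hdF : ((disc a b c : 𝒪[F]) : F) = disc (a : F) b c := rfl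
  have hres : ∀ z z' : 𝒪[F], IsLocalRing.residue 𝒪[F] z = IsLocalRing.residue 𝒪[F] z' ↔
      z - z' ∈ 𝓂[F] := fun z z' => by
    rw [← IsLocalRing.residue_eq_zero_iff, map_sub, sub_eq_zero]
  refine ⟨fun m hm => isDisjointUnion_of_pos hc hπ
    ((IsLocalRing.mem_maximalIdeal _).2 hπirr.not_isUnit) l hm, ?_, ?_, ?_⟩
  · intro hL
    obtain ⟨hsq, hdm⟩ : ¬ IsSquare ((disc a b c : 𝒪[F]) : F) ∧ disc a b c ∉ 𝓂[F] := by
      rw [legendreL] at hL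
      split_ifs at hL with h1 h2
      · exact ⟨h1, h2⟩
    exact isDisjointUnion_of_no_root hc hπ l fun z hz =>
      hsq ((isSquare_disc_of_root hdm hz).map (algebraMap 𝒪[F] F))
  · intro hL pL hpL
    have hdm : disc a b c ∈ 𝓂[F] := by
      rw [legendreL] at hL
      split_ifs at hL with h1 h2 <;> first | exact h2 | norm_num at hL
    have hmem := exists_mem_maximal_iff hc hdm pL hpL
    simp only [hmem]
    have hred : ∀ z : 𝒪[F], c * z ^ 2 + b * z + a ∈ 𝓂[F] ↔
        IsLocalRing.residue 𝒪[F] c * IsLocalRing.residue 𝒪[F] z ^ 2 +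
          IsLocalRing.residue 𝒪[F] b * IsLocalRing.residue 𝒪[F] z +
          IsLocalRing.residue 𝒪[F] a = 0 := fun z => by
      rw [← IsLocalRing.residue_eq_zero_iff]
      simp only [map_add, map_mul, map_pow]
    have huniq := existsUnique_root_of_disc_eq_zero (a := IsLocalRing.residue 𝒪[F] a)
      (b := IsLocalRing.residue 𝒪[F] b) (hc.map (IsLocalRing.residue 𝒪[F])).ne_zero (by
        rw [← IsLocalRing.residue_eq_zero_iff] at hdm
        rw [← hdm, disc, disc, map_sub, map_pow, map_mul, map_mul, map_ofNat])
    refine ⟨?_, ?_, ?_⟩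
    · obtain ⟨w, hw, hw'⟩ := huniq
      refine ⟨w, ?_, ?_⟩
      · rintro z rfl
        exact (hred z).2 hw
      · intro w₁ h₁
        obtain ⟨z, rfl⟩ := IsLocalRing.residue_surjective w₁
        exact hw' _ ((hred z).1 (h₁ z rfl))
    · intro hodd
      have h2 : IsUnit (2 : 𝒪[F]) := by
        rw [← IsLocalRing.residue_ne_zero_iff_isUnit, map_ofNat]
        intro h0
        have : Fintype 𝓀[F] := Fintype.ofFinite _
        have : CharP 𝓀[F] 2 := CharTwo.of_one_ne_zero_of_two_eq_zero one_ne_zero h0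
        rw [Nat.card_eq_fintype_card] at hodd
        exact (Nat.not_even_iff_odd.2 hodd) (Nat.even_iff.2 <| FiniteField.even_card_of_char_two
          (ringChar.eq 𝓀[F] 2))
      obtain ⟨e, he⟩ := (h2.mul hc).exists_right_inv
      have heF : (2 * c : F) * e = 1 := congrArg Subtype.val he
      refine ⟨-b * e, ?_, ?_⟩
      · rw [eq_div_iff (left_ne_zero_of_mul_eq_one heF)]
        push_cast
        linear_combination -b * heF
      · -- `4 c (c w² + b w + a) = -d` for `w = -b / (2 c)`
        have h1 : c * (-b * e) ^ 2 + b * (-b * e) + a = -(disc a b c) * (c * e ^ 2) := by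
          rw [disc]
          linear_combination (b ^ 2 * e - a * (2 * c * e + 1)) * he
        rw [h1]
        exact Ideal.mul_mem_right _ _ (neg_mem hdm)
    · intro w₀ hw₀
      refine isDisjointUnion_of_one_root hc hπ l w₀ fun z => ⟨fun hz => ?_, fun hz => ?_⟩
      · exact huniq.unique ((hred w₀).1 hw₀) ((hred z).1 hz)
      · rw [hred, ← hz, ← hred]
        exact hw₀
  · intro hL δ hδ
    have hdu : IsUnit (disc a b c) := by
      apply hA2'
      rw [← hdF]
      by_contra h
      rw [legendreL, if_neg h] at hL
      split_ifs at hL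
      norm_num at hL
    have h1 := root_mem_integer hc hδ
    have h2 : (-(b : F) - δ) / (2 * c) ∈ 𝒪[F] := by
      rw [sub_eq_add_neg]
      exact root_mem_integer hc (by rw [neg_sq, hδ])
    refine ⟨h1, h2, ?_⟩
    have hcF : (c : F) ≠ 0 := fun h => hc.ne_zero (Subtype.ext h)
    refine isDisjointUnion_of_two_roots hc hπ l ⟨_, h1⟩ ⟨_, h2⟩ ?_ ?_
    · -- the difference of the two zeros is `δ / c`, and `δ² = d` is a unit
      rw [ne_eq, hres]
      intro h
      refine (IsLocalRing.mem_maximalIdeal _).1 (?_ : disc a b c ∈ 𝓂[F]) hdu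
      have h3 := Ideal.mul_mem_left _ (c ^ 2) (Ideal.pow_mem_of_mem _ h 2 two_pos)
      convert h3 using 1
      apply Subtype.ext
      push_cast
      rw [hdF, ← hδ]
      field_simp
      ring
    · intro z
      apply Subtype.ext
      rw [disc] at hδ
      push_cast
      field_simp
      linear_combination hδ
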